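/- A Blaschke product is a rational map $r=p/q$ of degree at least $1$ whose restriction to the open unit disc $\mathbb{D}$ is a proper map of $\mathbb{D}$ onto $\mathbb{D}$. Let $A$, $B$ be Blaschke products of the same degree $d$, and let $\zeta\in\mathbb{D}$ be a point which is a critical value neither of $A$ nor of $B$. Given orderings $A^{-1}(\zeta)=\{a_1,\dots,a_d\}$ and $B^{-1}(\zeta)=\{b_1,\dots,b_d\}$ and a loop $\gamma:[0,1]\to\mathbb{D}$ based at $\zeta$ which avoids the critical values of $A$ and $B$, let $\gamma_A^*$ be the permutation of $\{1,\dots,d\}$ with $\gamma_A^*(i)=j$ if the lift of $\gamma$ under $A$ that starts at $a_i$ ends at $a_j$, and define $\gamma_B^*$ in the same way from $B$ and the $b_i$. Write $j\simeq k$ and $k\simeq j$ whenever there are such a loop $\gamma$ and an index $i$ with $\gamma_B^*(i)=j$ and $\gamma_A^*(i)=k$, and let $\sim$ be the equivalence relation on $\{1,\dots,d\}$ generated by $\simeq$. Call $\sim$ trivial if $j\sim k$ for all $j,k$, and non-trivial otherwise. Theorem. There are Blaschke products $A_1$, $B_1$, $C$ with $\deg C>1$, $A=C\circ A_1$ and $B=C\circ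 B_1$ if and only if there are orderings of $A^{-1}(\zeta)$ and $B^{-1}(\zeta)$ for which $\sim$ is non-trivial. -/

import Mathlib

open Complex
open scoped Complex.UnitDisc

noncomputable section

/-- The value `p z / q z` at `z ∈ ℂ` of the rational function `r = p / q`. -/
def ratValue (r : RatFunc ℂ) (z : ℂ) : ℂ := r.eval (RingHom.id ℂ) z

/-- The degree of `r = p / q` (in lowest terms) as a self-map of the Riemann sphere. -/
def ratDegree (r : RatFunc ℂ) : ℕ := max r.num.natDegree r.denom.natDegree

/-- The composition `r ∘ s` of rational functions: substitute `s` for the variable of `r`. -/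
def ratComp (r s : RatFunc ℂ) : RatFunc ℂ := r.eval RatFunc.C s

/-- A (finite) Blaschke product: a rational map of degree at least one whose restriction to the
open unit disc `𝔻` is a proper map of `𝔻` onto `𝔻`. -/
structure BlaschkeProduct where
  /-- the underlying rational function -/
  rat : RatFunc ℂ
  one_le_degree : 1 ≤ ratDegree rat
  /-- there are no poles in the disc -/
  denom_ne_zero : ∀ z : 𝔻, rat.denom.eval (z : ℂ) ≠ 0
  norm_value_lt_one : ∀ z : 𝔻, ‖ratValue rat z‖ < 1
  isProperMap : IsProperMap fun z : 𝔻 => UnitDisc.mk (ratValue rat z) (norm_value_lt_one z)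
  surjective : Function.Surjective
    fun z : 𝔻 => UnitDisc.mk (ratValue rat z) (norm_value_lt_one z)

namespace BlaschkeProduct

/-- The degree of a Blaschke product. -/
def degree (A : BlaschkeProduct) : ℕ := ratDegree A.rat

/-- The restriction of a Blaschke product to the unit disc. -/
def toDisc (A : BlaschkeProduct) (z : 𝔻) : 𝔻 :=
  UnitDisc.mk (ratValue A.rat z) (A.norm_value_lt_one z)

/-- The critical values of `A` in the disc. -/
def criticalValues (A : BlaschkeProduct) : Set 𝔻 :=
  {w | ∃ z : 𝔻, A.toDisc z = w ∧ deriv (ratValue A.rat) (z : ℂ) = 0}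

/-- The fibre `A⁻¹(ζ)` in the disc. -/
abbrev Fibre (A : BlaschkeProduct) (ζ : 𝔻) : Type := {z : 𝔻 // A.toDisc z = ζ}

/-- For a labelling `a` of the fibre `A⁻¹(ζ)` and a loop `γ` based at `ζ`, this is the relation
`γ_A^*(i) = j`: the arc over `γ` which starts at `a i` ends at `a j`. -/
def MonodromySends (A : BlaschkeProduct) {d : ℕ} {ζ : 𝔻} (a : Fin d ≃ A.Fibre ζ)
    (γ : Path ζ ζ) (i j : Fin d) : Prop :=
  ∃ Γ : Path (a i : 𝔻) (a j : 𝔻), ∀ t, A.toDisc (Γ t) = γ t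

/-- The relation `j ≃ k`: for some loop `γ` in `𝔻` based at `ζ` which avoids the critical values of
`A` and of `B`, and for some `i`, the labels `γ_B^*(i)` and `γ_A^*(i)` are `j` and `k`, in one or
the other order. -/
def PreRel (A B : BlaschkeProduct) {d : ℕ} {ζ : 𝔻} (a : Fin d ≃ A.Fibre ζ)
    (b : Fin d ≃ B.Fibre ζ) (j k : Fin d) : Prop :=
  ∃ γ : Path ζ ζ, (∀ t, γ t ∉ A.criticalValues ∧ γ t ∉ B.criticalValues) ∧
    ∃ i, (B.MonodromySends b γ i j ∧ A.MonodromySends a γ i k) ∨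
      (B.MonodromySends b γ i k ∧ A.MonodromySends a γ i j)

/-- The equivalence relation `∼` on the labels generated by `≃`. -/
def monodromySetoid (A B : BlaschkeProduct) {d : ℕ} {ζ : 𝔻} (a : Fin d ≃ A.Fibre ζ)
    (b : Fin d ≃ B.Fibre ζ) : Setoid (Fin d) :=
  Relation.EqvGen.setoid (PreRel A B a b)

/-- An equivalence relation is non-trivial if not all elements are equivalent to each other. -/
def IsNontrivialRel {d : ℕ} (s : Setoid (Fin d)) : Prop := ¬ ∀ j k : Fin d, s j k

end BlaschkeProduct

end

/-!
A common left factor `C` is visible in the monodromy: if `A = C ∘ A₁` and `B = C ∘ B₁`, a lift of a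
loop `γ` under `A` or `B` is mapped by `A₁` or `B₁` to a lift of `γ` under `C`. The fibres over `ζ`
are ordered such that `A₁ (a i) = B₁ (b i)`, which is possible because all fibres of `A₁` and `B₁`
over `C⁻¹(ζ)` have the same number `deg A / deg C` of points. By uniqueness of lifts, `γ_A^*(i)` and
`γ_B^*(i)` then label points with the same image in `C⁻¹(ζ)`, so the classes of `∼` are contained in
the fibres of `i ↦ A₁ (a i)` (`exists_isNontrivialRel_of_ratComp`).

For the converse, the monodromy groups of `A` and of `B` permute the classes of `∼`, and a loop acts
on the classes in the same way through `A` and through `B` (`rel_of_sends_of_rel`). Transport along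
paths from `ζ` therefore cuts every regular fibre of `A` and of `B` into blocks labelled by classes,
and the blocks of `A⁻¹(w)` and of `B⁻¹(w)` correspond to each other independently of the path. Let
`φ` be the Möbius transformation of the disc with zero `a i₀`, and put

  `A₁ z = ∏ φ z'` over the block of `z`,  `B₁ y = ∏ φ z'` over the block of `A⁻¹(B y)` which
  corresponds to the block of `y`.

No uniformization of the quotient by the blocks is needed: these functions are holomorphic, bounded
by `1`, and of modulus tending to `1` at the boundary, and a holomorphic function of this kind is
rational, since its finitely many zeros can be divided out by Möbius factors
(`exists_eq_div_of_tendsto_norm`). So `A₁` and `B₁` are Blaschke products. The zeros of `A₁` are the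
points of the block of `a i₀`, and they are simple, so the degree of `A₁` is the size of this block.
If the block is chosen of minimal size, the fibre of `A₁` through a regular point of `A` is a block,
hence `A` is constant on all but finitely many fibres of `A₁`, and `A = C ∘ A₁`
(`exists_ratComp_of_fibres`). As `B₁ y = A₁ z` for a point `z` with `A z = B y`, also
`B = C ∘ B₁`. Finally `deg C > 1` because `A₁` separates the block of `a i₀` from the others.

The degree of a Blaschke product `p / q` is counted in fibres by the reflection principle: `‖p‖ < ‖q‖`
in the disc, `‖p‖ = ‖q‖` on the circle and `‖p‖ > ‖q‖` outside of it, also at infinity, so that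
`p - ζ q` has full degree and all its zeros in the disc (`isRoot_num_sub_iff`, `card_fibre`).
-/

section DiscAnalysis

open Complex Filter Topology Metric Set Polynomial
open scoped Complex.UnitDisc ComplexConjugate

/-! ### Topology of the disc -/

instance Complex.UnitDisc.instT2Space : T2Space 𝔻 := UnitDisc.isEmbedding_coe.t2Space

theorem Complex.UnitDisc.isOpenEmbedding_coe : IsOpenEmbedding ((↑) : 𝔻 → ℂ) :=
  isOpen_ball.isOpenEmbedding_subtypeVal

instance Complex.UnitDisc.instLocallyCompactSpace : LocallyCompactSpace 𝔻 :=
  UnitDisc.isOpenEmbedding_coe.locallyCompactSpace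

theorem Complex.UnitDisc.coe_mem_ball (z : 𝔻) : (z : ℂ) ∈ ball (0 : ℂ) 1 :=
  mem_ball_zero_iff.2 z.norm_lt_one

/-- Neighbourhoods of infinity in `𝔻` are the sets which contain an annulus at the boundary, so
that `Tendsto _ (cocompact 𝔻) _` is the limit as `‖z‖ → 1`. -/
theorem Complex.UnitDisc.hasBasis_cocompact :
    (cocompact 𝔻).HasBasis (fun ρ : ℝ => ρ < 1) fun ρ => {z : 𝔻 | ρ < ‖(z : ℂ)‖} := by
  refine ⟨fun t => ?_⟩
  rw [mem_cocompact]
  constructor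
  · rintro ⟨K, hK, hKt⟩
    rcases K.eq_empty_or_nonempty with rfl | hne
    · exact ⟨0, one_pos, fun z _ => hKt (by simp)⟩
    · obtain ⟨m, hm, hmax⟩ := hK.exists_isMaxOn hne
        (f := fun z : 𝔻 => ‖(z : ℂ)‖) (UnitDisc.continuous_coe.norm.continuousOn)
      refine ⟨‖(m : ℂ)‖, m.norm_lt_one, fun z hz => hKt fun hzK => ?_⟩
      exact (not_le.2 hz) (isMaxOn_iff.1 hmax z hzK)
  · rintro ⟨ρ, hρ, ht⟩
    refine ⟨{z : 𝔻 | ‖(z : ℂ)‖ ≤ ρ}, ?_, fun z hz => ht (by simpa using hz)⟩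
    rw [UnitDisc.isEmbedding_coe.isCompact_iff]
    convert isCompact_closedBall (0 : ℂ) ρ using 1
    ext w
    simp only [mem_image, mem_ofPred_eq, mem_closedBall, dist_zero_right]
    constructor
    · rintro ⟨z, hz, rfl⟩; exact hz
    · intro hw; exact ⟨UnitDisc.mk w (hw.trans_lt hρ), hw, rfl⟩

instance Complex.UnitDisc.instNeBotCocompact : (cocompact 𝔻).NeBot := by
  rw [UnitDisc.hasBasis_cocompact.neBot_iff]
  intro ρ hρ
  obtain ⟨r, hr, hr1⟩ := exists_between (max_lt hρ one_pos)
  refine ⟨UnitDisc.mk (r : ℂ) ?_, ?_⟩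
  · rw [Complex.norm_real, Real.norm_of_nonneg ((le_max_right _ _).trans hr.le)]; exact hr1
  · change ρ < ‖(r : ℂ)‖
    rw [Complex.norm_real, Real.norm_of_nonneg ((le_max_right _ _).trans hr.le)]
    exact (le_max_left _ _).trans_lt hr

theorem Complex.UnitDisc.tendsto_norm_cocompact :
    Tendsto (fun z : 𝔻 => ‖(z : ℂ)‖) (cocompact 𝔻) (𝓝 1) := by
  refine tendsto_order.2 ⟨fun c hc => ?_, fun c hc => ?_⟩
  · exact UnitDisc.hasBasis_cocompact.mem_of_mem hc
  · exact Eventually.of_forall fun z => z.norm_lt_one.trans hc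

theorem Complex.UnitDisc.isPathConnected_compl {s : Set 𝔻} (hs : s.Finite) :
    IsPathConnected sᶜ := by
  let e : ℂ ≃ₜ 𝔻 := (Homeomorph.unitBall (E := ℂ) : ℂ ≃ₜ ball (0 : ℂ) 1)
  have h : IsPathConnected (e ⁻¹' s)ᶜ :=
    Set.Countable.isPathConnected_compl_of_one_lt_rank (by simp)
      ((hs.preimage e.injective.injOn).countable)
  have := h.image e.continuous
  rwa [← preimage_compl, image_preimage_eq _ e.surjective] at this

/-! ### Holomorphic functions on the disc with unimodular boundary values -/

/-- Maximum principle: a limit of `‖g‖` at the boundary of the disc bounds `‖g‖` on the disc. -/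
theorem norm_le_of_tendsto_norm_cocompact {g : ℂ → ℂ} (hg : DifferentiableOn ℂ g (ball 0 1))
    {L : ℝ} (h : Tendsto (fun z : 𝔻 => ‖g z‖) (cocompact 𝔻) (𝓝 L)) {z : ℂ} (hz : ‖z‖ < 1) :
    ‖g z‖ ≤ L := by
  refine le_of_forall_gt_imp_ge_of_dense fun c hc => ?_
  obtain ⟨ρ, hρ, hρc⟩ := UnitDisc.hasBasis_cocompact.mem_iff.1 (h.eventually_lt_const hc)
  obtain ⟨r, hr, hr1⟩ := exists_between (max_lt hρ hz)
  have hr0 : 0 < r := (norm_nonneg z).trans_lt ((le_max_right _ _).trans_lt hr)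
  refine norm_le_of_forall_mem_frontier_norm_le (isBounded_ball (x := (0 : ℂ)) (r := r))
    (DifferentiableOn.diffContOnCl_ball (U := ball 0 1) hg (closedBall_subset_ball hr1)) ?_
    (subset_closure (mem_ball_zero_iff.2 ((le_max_right _ _).trans_lt hr)))
  intro w hw
  rw [frontier_ball _ hr0.ne', mem_sphere_zero_iff_norm] at hw
  have : UnitDisc.mk w (hw ▸ hr1) ∈ {z : 𝔻 | ‖g z‖ < c} :=
    hρc (show ρ < ‖w‖ from hw ▸ (le_max_left _ _).trans_lt hr)
  exact le_of_lt this

/-- The Möbius transformation of the disc which takes `a` to `0`. -/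
noncomputable def discMobius (a z : ℂ) : ℂ := (z - a) / (1 - conj a * z)

theorem one_sub_conj_mul_ne_zero {a z : ℂ} (ha : ‖a‖ < 1) (hz : ‖z‖ < 1) :
    1 - conj a * z ≠ 0 := by
  intro h
  have h1 : ‖conj a * z‖ = 1 := by rw [← sub_eq_zero.1 h]; simp
  rw [norm_mul, RCLike.norm_conj] at h1
  nlinarith [norm_nonneg a, norm_nonneg z]

theorem norm_sq_discMobius {a z : ℂ} (ha : ‖a‖ < 1) (hz : ‖z‖ < 1) :
    ‖discMobius a z‖ ^ 2 = 1 - (1 - ‖a‖ ^ 2) * (1 - ‖z‖ ^ 2) / ‖1 - conj a * z‖ ^ 2 := by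
  have h0 : ‖1 - conj a * z‖ ^ 2 ≠ 0 :=
    pow_ne_zero _ (norm_ne_zero_iff.2 (one_sub_conj_mul_ne_zero ha hz))
  have key : ‖z - a‖ ^ 2 = ‖1 - conj a * z‖ ^ 2 - (1 - ‖a‖ ^ 2) * (1 - ‖z‖ ^ 2) := by
    simp only [← Complex.normSq_eq_norm_sq, Complex.normSq_apply, sub_re, sub_im, mul_re, mul_im,
      conj_re, conj_im, one_re, one_im]
    ring
  rw [discMobius, norm_div, div_pow, key, sub_div, div_self h0]

theorem norm_discMobius_lt_one {a z : ℂ} (ha : ‖a‖ < 1) (hz : ‖z‖ < 1) :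
    ‖discMobius a z‖ < 1 := by
  have h0 : 0 < ‖1 - conj a * z‖ := norm_pos_iff.2 (one_sub_conj_mul_ne_zero ha hz)
  have h1 : 0 < (1 - ‖a‖ ^ 2) * (1 - ‖z‖ ^ 2) / ‖1 - conj a * z‖ ^ 2 := by
    have : 0 < 1 - ‖a‖ ^ 2 := by nlinarith [norm_nonneg a]
    have : 0 < 1 - ‖z‖ ^ 2 := by nlinarith [norm_nonneg z]
    positivity
  have := norm_sq_discMobius ha hz
  nlinarith [norm_nonneg (discMobius a z)]

theorem discMobius_eq_zero {a z : ℂ} (ha : ‖a‖ < 1) (hz : ‖z‖ < 1) :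
    discMobius a z = 0 ↔ z = a := by
  simp [discMobius, one_sub_conj_mul_ne_zero ha hz, sub_eq_zero]

theorem hasDerivAt_discMobius_self {a : ℂ} (ha : ‖a‖ < 1) :
    HasDerivAt (discMobius a) (1 - conj a * a)⁻¹ a := by
  have h0 := one_sub_conj_mul_ne_zero ha ha
  have h1 : HasDerivAt (fun z : ℂ => z - a) 1 a := (hasDerivAt_id a).sub_const a
  have h2 : HasDerivAt (fun z : ℂ => 1 - conj a * z) (-(conj a * 1)) a :=
    ((hasDerivAt_id a).const_mul _).const_sub 1
  refine (h1.div h2 h0).congr_deriv ?_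
  field_simp
  simp

theorem differentiableAt_discMobius {a z : ℂ} (ha : ‖a‖ < 1) (hz : ‖z‖ < 1) :
    DifferentiableAt ℂ (discMobius a) z := by
  have h0 := one_sub_conj_mul_ne_zero ha hz
  unfold discMobius
  fun_prop (disch := assumption)

theorem tendsto_norm_discMobius {a : ℂ} (ha : ‖a‖ < 1) :
    Tendsto (fun z : 𝔻 => ‖discMobius a z‖) (cocompact 𝔻) (𝓝 1) := by
  have hlow : Tendsto (fun z : 𝔻 => 1 - (1 - ‖a‖ ^ 2) * (1 - ‖(z : ℂ)‖ ^ 2) / (1 - ‖a‖) ^ 2)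
      (cocompact 𝔻) (𝓝 1) := by
    have := ((UnitDisc.tendsto_norm_cocompact.pow 2).const_sub 1).const_mul (1 - ‖a‖ ^ 2)
    have := (this.div_const ((1 - ‖a‖) ^ 2)).const_sub 1
    simpa using this
  refine tendsto_of_tendsto_of_tendsto_of_le_of_le hlow tendsto_const_nhds (fun z => ?_)
    fun z => (norm_discMobius_lt_one ha z.norm_lt_one).le
  have h1 := norm_discMobius_lt_one ha z.norm_lt_one
  have h2 := norm_sq_discMobius ha z.norm_lt_one
  have h3 : 1 - ‖a‖ ≤ ‖1 - conj a * z‖ := by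
    have := norm_sub_norm_le (1 : ℂ) (conj a * z)
    rw [norm_one, norm_mul, RCLike.norm_conj] at this
    nlinarith [norm_nonneg a, z.norm_lt_one]
  have h4 : (1 - ‖a‖ ^ 2) * (1 - ‖(z : ℂ)‖ ^ 2) / ‖1 - conj a * z‖ ^ 2 ≤
      (1 - ‖a‖ ^ 2) * (1 - ‖(z : ℂ)‖ ^ 2) / (1 - ‖a‖) ^ 2 := by
    have : 0 ≤ 1 - ‖a‖ ^ 2 := by nlinarith [norm_nonneg a]
    have : 0 ≤ 1 - ‖(z : ℂ)‖ ^ 2 := by nlinarith [norm_nonneg (z : ℂ), z.norm_lt_one]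
    have : 0 < 1 - ‖a‖ := by linarith
    gcongr
  dsimp only
  nlinarith [norm_nonneg (discMobius a z)]

/-- A zero-free holomorphic function with unimodular boundary values is constant, by the maximum
principle for the function and its reciprocal. -/
theorem eq_const_of_tendsto_norm {g : ℂ → ℂ} (hg : DifferentiableOn ℂ g (ball 0 1))
    (ht : Tendsto (fun z : 𝔻 => ‖g z‖) (cocompact 𝔻) (𝓝 1))
    (h0 : ∀ z ∈ ball (0 : ℂ) 1, g z ≠ 0) {z : ℂ} (hz : z ∈ ball (0 : ℂ) 1) : g z = g 0 := by
  have h1 : ∀ z ∈ ball (0 : ℂ) 1, ‖g z‖ = 1 := fun z hz => by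
    rw [mem_ball_zero_iff] at hz
    refine le_antisymm (norm_le_of_tendsto_norm_cocompact hg ht hz) ?_
    have hi : Tendsto (fun z : 𝔻 => ‖(fun z => (g z)⁻¹) (z : ℂ)‖) (cocompact 𝔻) (𝓝 1) := by
      simpa using ht.inv₀ one_ne_zero
    have := norm_le_of_tendsto_norm_cocompact (hg.inv h0) hi hz
    rw [Pi.inv_apply, norm_inv] at this
    exact (inv_le_one₀ (norm_pos_iff.2 (h0 z (mem_ball_zero_iff.2 hz)))).1 this
  exact eqOn_of_isPreconnected_of_isMaxOn_norm (convex_ball (0 : ℂ) 1).isPreconnected isOpen_ball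
    hg (mem_ball_self one_pos)
    (fun w hw => by simp [h1 w hw, h1 0 (mem_ball_self one_pos)]) hz

theorem finite_zeros_of_tendsto_norm {g : ℂ → ℂ} (hg : DifferentiableOn ℂ g (ball 0 1))
    (ht : Tendsto (fun z : 𝔻 => ‖g z‖) (cocompact 𝔻) (𝓝 1)) :
    (∀ a ∈ ball (0 : ℂ) 1, ¬ ∃ᶠ z in 𝓝[≠] a, g z = 0) ∧
      {z ∈ ball (0 : ℂ) 1 | g z = 0}.Finite := by
  have h0 : ∀ a ∈ ball (0 : ℂ) 1, ¬ ∃ᶠ z in 𝓝[≠] a, g z = 0 := by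
    intro a ha hf
    have hz := (hg.analyticOnNhd isOpen_ball).eqOn_zero_of_preconnected_of_frequently_eq_zero
      (convex_ball (0 : ℂ) 1).isPreconnected ha hf
    have : Tendsto (fun z : 𝔻 => ‖g z‖) (cocompact 𝔻) (𝓝 0) := by
      refine tendsto_const_nhds.congr fun z => ?_
      rw [hz z.coe_mem_ball]; simp
    exact zero_ne_one (tendsto_nhds_unique this ht)
  refine ⟨h0, ?_⟩
  obtain ⟨ρ, hρ, hρc⟩ := UnitDisc.hasBasis_cocompact.mem_iff.1
    (ht.eventually_const_lt (zero_lt_one' ℝ))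
  by_contra hinf
  obtain ⟨a, ha, hacc⟩ := Set.Infinite.exists_accPt_of_subset_isCompact hinf
    (isCompact_closedBall (0 : ℂ) ρ) (by
      rintro z ⟨hz, hgz⟩
      rw [mem_closedBall_zero_iff]
      by_contra hlt
      have : UnitDisc.mk z (mem_ball_zero_iff.1 hz) ∈ {z : 𝔻 | 0 < ‖g z‖} := hρc (not_le.1 hlt)
      have : 0 < ‖g z‖ := this
      simp [hgz] at this)
  refine h0 a (closedBall_subset_ball hρ ha) ?_
  exact (accPt_iff_frequently_nhdsNE.1 hacc).mono fun z hz => hz.2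

/-- A holomorphic function on the disc with unimodular boundary values is rational: dividing by
a power of a Möbius factor removes a zero, and without zeros the function is constant. -/
theorem exists_eq_div_of_tendsto_norm {g : ℂ → ℂ} (hg : DifferentiableOn ℂ g (ball 0 1))
    (ht : Tendsto (fun z : 𝔻 => ‖g z‖) (cocompact 𝔻) (𝓝 1)) :
    ∃ P Q : ℂ[X], ∀ z ∈ ball (0 : ℂ) 1, Q.eval z ≠ 0 ∧ g z = P.eval z / Q.eval z := by
  induction hn : {z ∈ ball (0 : ℂ) 1 | g z = 0}.ncard using Nat.strong_induction_on
    generalizing g with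
  | _ m ih =>
  obtain ⟨hne, hfin⟩ := finite_zeros_of_tendsto_norm hg ht
  by_cases hz : ∀ z ∈ ball (0 : ℂ) 1, g z ≠ 0
  · exact ⟨C (g 0), 1, fun z hz' => by simp [eq_const_of_tendsto_norm hg ht hz hz']⟩
  push Not at hz
  obtain ⟨a, ha, hga⟩ := hz
  have ha' : ‖a‖ < 1 := mem_ball_zero_iff.1 ha
  obtain ⟨n, k, hk, hka, hgk⟩ :=
    (hg.analyticAt (isOpen_ball.mem_nhds ha)).exists_eventuallyEq_pow_smul_nonzero_iff.2
      fun h => hne a ha (h.filter_mono nhdsWithin_le_nhds).frequently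
  have hn0 : n ≠ 0 := by
    rintro rfl
    have := hgk.self_of_nhds
    simp [hga] at this
    exact hka this.symm
  let h : ℂ → ℂ := fun z => if z = a then k z * (1 - conj a * z) ^ n else g z / discMobius a z ^ n
  have hh : ∀ z ∈ ball (0 : ℂ) 1, z ≠ a → h z = g z / discMobius a z ^ n :=
    fun z _ hza => if_neg hza
  have hmul : ∀ z ∈ ball (0 : ℂ) 1, g z = h z * discMobius a z ^ n := by
    intro z hz
    by_cases hza : z = a
    · subst hza
      rw [hga, (discMobius_eq_zero ha' ha').2 rfl, zero_pow hn0, mul_zero]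
    · rw [hh z hz hza, div_mul_cancel₀]
      exact pow_ne_zero _ (mt (discMobius_eq_zero ha' (mem_ball_zero_iff.1 hz)).1 hza)
  have hd : DifferentiableOn ℂ h (ball 0 1) := by
    intro z hz
    have hz' : ‖z‖ < 1 := mem_ball_zero_iff.1 hz
    refine DifferentiableAt.differentiableWithinAt ?_
    by_cases hza : z = a
    · subst hza
      have : h =ᶠ[𝓝 z] fun w => k w * (1 - conj z * w) ^ n := by
        filter_upwards [hgk, isOpen_ball.mem_nhds hz] with w hw hwb
        by_cases hwz : w = z
        · exact if_pos hwz
        · have h1 : (w - z) ^ n ≠ 0 := pow_ne_zero _ (sub_ne_zero.2 hwz)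
          rw [hh w hwb hwz, hw, discMobius, div_pow, smul_eq_mul]
          field_simp
      refine DifferentiableAt.congr_of_eventuallyEq ?_ this
      exact hk.differentiableAt.mul (by fun_prop)
    · have : h =ᶠ[𝓝 z] fun w => g w / discMobius a w ^ n := by
        filter_upwards [isOpen_ne.mem_nhds hza] with w hw
        exact if_neg hw
      refine DifferentiableAt.congr_of_eventuallyEq ?_ this
      exact (hg.differentiableAt (isOpen_ball.mem_nhds hz)).div
        ((differentiableAt_discMobius ha' hz').pow n)
        (pow_ne_zero _ (mt (discMobius_eq_zero ha' hz').1 hza))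
  have hht : Tendsto (fun z : 𝔻 => ‖h z‖) (cocompact 𝔻) (𝓝 1) := by
    have h1 := ht.div ((tendsto_norm_discMobius ha').pow n) (by simp)
    rw [one_pow, div_one] at h1
    refine h1.congr' ?_
    have : {UnitDisc.mk a ha'}ᶜ ∈ cocompact 𝔻 := isCompact_singleton.compl_mem_cocompact
    filter_upwards [this] with z hz
    rw [hh z z.coe_mem_ball fun h => hz (UnitDisc.coe_injective h)]
    simp
  have hlt : {z ∈ ball (0 : ℂ) 1 | h z = 0}.ncard < m := by
    rw [← hn]
    refine ncard_lt_ncard ⟨?_, fun hsub => ?_⟩ hfin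
    · rintro z ⟨hz, hhz⟩
      exact ⟨hz, by rw [hmul z hz, hhz, zero_mul]⟩
    · have : h a = 0 := (hsub ⟨ha, hga⟩ : a ∈ {z ∈ ball (0 : ℂ) 1 | h z = 0}).2
      simp only [h, if_true] at this
      exact mul_ne_zero hka (pow_ne_zero _ (one_sub_conj_mul_ne_zero ha' ha')) this
  obtain ⟨P, Q, hPQ⟩ := ih _ hlt hd hht rfl
  refine ⟨P * (X - C a) ^ n, Q * (1 - C (conj a) * X) ^ n, fun z hz => ?_⟩
  have h2 := one_sub_conj_mul_ne_zero ha' (mem_ball_zero_iff.1 hz)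
  refine ⟨by simpa using ⟨(hPQ z hz).1, fun h => absurd h h2⟩, ?_⟩
  rw [hmul z hz, (hPQ z hz).2, discMobius]
  simp [div_pow, mul_div_mul_comm]

/-- Removable singularities, for finitely many of them at once. -/
theorem exists_differentiableOn_ball_of_finite {S : Set ℂ} (hS : S.Finite) {f : ℂ → ℂ}
    (hd : DifferentiableOn ℂ f (ball 0 1 \ S)) (hb : ∀ z ∈ ball (0 : ℂ) 1 \ S, ‖f z‖ ≤ 1) :
    ∃ g : ℂ → ℂ, DifferentiableOn ℂ g (ball 0 1) ∧ ∀ z ∈ ball (0 : ℂ) 1 \ S, g z = f z := by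
  induction S, hS using Set.Finite.induction_on generalizing f with
  | empty => exact ⟨f, by simpa using hd, fun _ _ => rfl⟩
  | @insert a S haS hS ih =>
    by_cases ha : a ∈ ball (0 : ℂ) 1
    · have hopen : IsOpen (ball (0 : ℂ) 1 \ S) := isOpen_ball.sdiff hS.isClosed
      have hnhds : ball (0 : ℂ) 1 \ S ∈ 𝓝 a := hopen.mem_nhds ⟨ha, haS⟩
      have heq : ball (0 : ℂ) 1 \ insert a S = (ball (0 : ℂ) 1 \ S) \ {a} := by
        ext z; simp only [Set.mem_sdiff, mem_insert_iff, mem_singleton_iff]; tauto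
      rw [heq] at hd hb
      have hd' := differentiableOn_update_limUnder_of_bddAbove hnhds hd
        ⟨1, by rintro _ ⟨z, hz, rfl⟩; exact hb z hz⟩
      obtain ⟨g, hg, hgf⟩ := ih hd' (by
        intro z hz
        by_cases hza : z = a
        · subst hza
          have hc := (hd'.differentiableAt hnhds).continuousAt.norm.tendsto.mono_left
            (nhdsWithin_le_nhds (s := {z}ᶜ))
          refine le_of_tendsto hc ?_
          filter_upwards [nhdsWithin_le_nhds hnhds, self_mem_nhdsWithin] with w hw hwz
          rw [Function.update_of_ne hwz]
          exact hb w ⟨hw, hwz⟩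
        · rw [Function.update_of_ne hza]
          exact hb z ⟨hz, hza⟩)
      refine ⟨g, hg, fun z hz => ?_⟩
      rw [heq] at hz
      rw [hgf z hz.1, Function.update_of_ne hz.2]
    · have heq : ball (0 : ℂ) 1 \ insert a S = ball (0 : ℂ) 1 \ S := by
        ext z
        simp only [Set.mem_sdiff, mem_insert_iff]
        exact ⟨fun h => ⟨h.1, fun h' => h.2 (.inr h')⟩,
          fun h => ⟨h.1, fun h' => h'.elim (fun e => ha (e ▸ h.1)) h.2⟩⟩
      rw [heq] at hd hb ⊢
      exact ih hd hb

end DiscAnalysis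

section InnerRationalFunctions

open Complex Filter Topology Metric Set Polynomial
open scoped Complex.UnitDisc ComplexConjugate

/-! ### Values of rational functions -/

/-- The rational function `r` is regular at `z`, with value `v`. -/
def RatFunc.HasValue (r : RatFunc ℂ) (z v : ℂ) : Prop :=
  ∃ P Q : ℂ[X], Q.eval z ≠ 0 ∧ r = algebraMap _ _ P / algebraMap _ _ Q ∧ v = P.eval z / Q.eval z

namespace RatFunc

theorem HasValue.denom_ne_zero {r : RatFunc ℂ} {z v : ℂ} (h : r.HasValue z v) :
    r.denom.eval z ≠ 0 := by
  obtain ⟨P, Q, hQ, rfl, rfl⟩ := h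
  obtain ⟨c, hc⟩ := denom_div_dvd (K := ℂ) P Q
  intro h0
  rw [hc, Polynomial.eval_mul, h0, zero_mul] at hQ
  exact hQ rfl

theorem ratValue_eq (r : RatFunc ℂ) (z : ℂ) :
    ratValue r z = r.num.eval z / r.denom.eval z := by
  simp [ratValue, RatFunc.eval, Polynomial.eval₂_id]

theorem HasValue.ratValue_eq {r : RatFunc ℂ} {z v : ℂ} (h : r.HasValue z v) :
    ratValue r z = v := by
  have hd := h.denom_ne_zero
  obtain ⟨P, Q, hQ, hr, rfl⟩ := h
  have hQ0 : Q ≠ 0 := by rintro rfl; simp at hQ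
  have := congrArg (Polynomial.eval z) ((num_mul_eq_mul_denom_iff hQ0).2 hr)
  rw [Polynomial.eval_mul, Polynomial.eval_mul] at this
  rw [RatFunc.ratValue_eq, div_eq_div_iff hd hQ, this]

theorem hasValue_ratValue {r : RatFunc ℂ} {z : ℂ} (h : r.denom.eval z ≠ 0) :
    r.HasValue z (ratValue r z) :=
  ⟨r.num, r.denom, h, (num_div_denom r).symm, RatFunc.ratValue_eq r z⟩

theorem hasValue_C (c z : ℂ) : (RatFunc.C c).HasValue z c :=
  ⟨Polynomial.C c, 1, by simp, by simp, by simp⟩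

theorem algebraMap_ne_zero_of_eval {Q : ℂ[X]} {z : ℂ} (h : Q.eval z ≠ 0) :
    algebraMap ℂ[X] (RatFunc ℂ) Q ≠ 0 :=
  RatFunc.algebraMap_ne_zero (by rintro rfl; simp at h)

theorem HasValue.add {r s : RatFunc ℂ} {z v w : ℂ} (hr : r.HasValue z v) (hs : s.HasValue z w) :
    (r + s).HasValue z (v + w) := by
  obtain ⟨P, Q, hQ, rfl, rfl⟩ := hr
  obtain ⟨P', Q', hQ', rfl, rfl⟩ := hs
  refine ⟨P * Q' + Q * P', Q * Q', by simpa using ⟨hQ, hQ'⟩, ?_, ?_⟩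
  · rw [div_add_div _ _ (algebraMap_ne_zero_of_eval hQ) (algebraMap_ne_zero_of_eval hQ')]
    simp
  · rw [div_add_div _ _ hQ hQ']; simp

theorem HasValue.mul {r s : RatFunc ℂ} {z v w : ℂ} (hr : r.HasValue z v) (hs : s.HasValue z w) :
    (r * s).HasValue z (v * w) := by
  obtain ⟨P, Q, hQ, rfl, rfl⟩ := hr
  obtain ⟨P', Q', hQ', rfl, rfl⟩ := hs
  refine ⟨P * P', Q * Q', by simpa using ⟨hQ, hQ'⟩, ?_, ?_⟩
  · rw [div_mul_div_comm]; simp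
  · rw [div_mul_div_comm]; simp

theorem HasValue.div {r s : RatFunc ℂ} {z v w : ℂ} (hr : r.HasValue z v) (hs : s.HasValue z w)
    (hw : w ≠ 0) : (r / s).HasValue z (v / w) := by
  obtain ⟨P, Q, hQ, rfl, rfl⟩ := hr
  obtain ⟨P', Q', hQ', rfl, rfl⟩ := hs
  have hP' : P'.eval z ≠ 0 := fun h => hw (by simp [h])
  refine ⟨P * Q', Q * P', by simpa using ⟨hQ, hP'⟩, ?_, ?_⟩
  · rw [div_div_div_eq]; simp
  · rw [div_div_div_eq]; simp

theorem HasValue.eval₂ {s : RatFunc ℂ} {z w : ℂ} (hs : s.HasValue z w) (P : ℂ[X]) :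
    (P.eval₂ RatFunc.C s).HasValue z (P.eval w) := by
  induction P using Polynomial.induction_on' with
  | add p q hp hq => simpa using hp.add hq
  | monomial n c =>
    rw [Polynomial.eval₂_monomial, Polynomial.eval_monomial]
    refine (hasValue_C c z).mul ?_
    induction n with
    | zero => simpa using hasValue_C 1 z
    | succ n ih => rw [pow_succ, pow_succ]; exact ih.mul hs

theorem HasValue.ratComp {r s : RatFunc ℂ} {z w : ℂ} (hs : s.HasValue z w)
    (hr : r.denom.eval w ≠ 0) : (ratComp r s).HasValue z (ratValue r w) := by
  rw [RatFunc.ratValue_eq]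
  exact (hs.eval₂ r.num).div (hs.eval₂ r.denom) hr

theorem eq_of_infinite_hasValue {r s : RatFunc ℂ}
    (h : {z : ℂ | ∃ v, r.HasValue z v ∧ s.HasValue z v}.Infinite) : r = s := by
  rw [← num_div_denom s, ← num_mul_eq_mul_denom_iff s.denom_ne_zero]
  refine Polynomial.eq_of_infinite_eval_eq _ _ (h.mono ?_)
  rintro z ⟨v, hr, hs⟩
  have h1 := hr.ratValue_eq.trans hs.ratValue_eq.symm
  rw [RatFunc.ratValue_eq, RatFunc.ratValue_eq,
    div_eq_div_iff hr.denom_ne_zero hs.denom_ne_zero] at h1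
  simpa using h1

theorem hasStrictDerivAt_ratValue {r : RatFunc ℂ} {z : ℂ} (h : r.denom.eval z ≠ 0) :
    HasStrictDerivAt (ratValue r) ((r.num.derivative.eval z * r.denom.eval z -
      r.num.eval z * r.denom.derivative.eval z) / r.denom.eval z ^ 2) z := by
  have := (r.num.hasStrictDerivAt z).div (r.denom.hasStrictDerivAt z) h
  exact this.congr_of_eventuallyEq (.of_forall fun w => (RatFunc.ratValue_eq r w).symm)

/-! ### Rational functions with unimodular boundary values -/

theorem eval_reflect_map_conj {P : ℂ[X]} {N : ℕ} (hP : P.natDegree ≤ N) {z : ℂ} (hz : z ≠ 0) :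
    ((P.map (starRingEnd ℂ)).reflect N).eval z * z⁻¹ ^ N = conj (P.eval (conj z⁻¹)) := by
  let : Invertible z⁻¹ := invertibleOfNonzero (inv_ne_zero hz)
  have h := Polynomial.eval₂_reflect_mul_pow (RingHom.id ℂ) z⁻¹ N
    (P.map (starRingEnd ℂ)) (by simpa using hP)
  rw [invOf_eq_inv, inv_inv, Polynomial.eval₂_id, Polynomial.eval₂_id] at h
  rw [h, Polynomial.eval_map, ← Complex.conj_conj z⁻¹, Polynomial.eval₂_at_apply,
    Complex.conj_conj]

/-- The rational function `r` maps the disc to itself and `‖r z‖ → 1` as `‖z‖ → 1`. -/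
structure IsInner (r : RatFunc ℂ) : Prop where
  denom_ne_zero : ∀ z : 𝔻, r.denom.eval (z : ℂ) ≠ 0
  norm_lt_one : ∀ z : 𝔻, ‖ratValue r z‖ < 1
  tendsto_norm : Tendsto (fun z : 𝔻 => ‖ratValue r z‖) (cocompact 𝔻) (𝓝 1)

namespace IsInner

variable {r : RatFunc ℂ} (hr : r.IsInner)
include hr

theorem norm_num_lt {z : ℂ} (hz : ‖z‖ < 1) : ‖r.num.eval z‖ < ‖r.denom.eval z‖ := by
  have h1 := hr.norm_lt_one (UnitDisc.mk z hz)
  have h2 := hr.denom_ne_zero (UnitDisc.mk z hz)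
  rw [UnitDisc.coe_mk] at h1 h2
  rwa [RatFunc.ratValue_eq, norm_div, div_lt_one (norm_pos_iff.2 h2)] at h1

theorem norm_num_eq {z : ℂ} (hz : ‖z‖ = 1) : ‖r.num.eval z‖ = ‖r.denom.eval z‖ := by
  have hcl : z ∈ closure (ball (0 : ℂ) 1) := by
    rw [closure_ball _ one_ne_zero, mem_closedBall_zero_iff, hz]
  refine le_antisymm ?_ (not_lt.1 fun hlt => ?_)
  · refine closure_minimal (t := {z | ‖r.num.eval z‖ ≤ ‖r.denom.eval z‖}) (fun w hw => ?_)
      (isClosed_le r.num.continuous.norm r.denom.continuous.norm) hcl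
    exact (hr.norm_num_lt (mem_ball_zero_iff.1 hw)).le
  · have h0 : 0 < ‖r.denom.eval z‖ := (norm_nonneg _).trans_lt hlt
    obtain ⟨c, hc, hc1⟩ := exists_between ((div_lt_one h0).2 hlt)
    rw [div_lt_iff₀ h0] at hc
    obtain ⟨ρ, hρ, hρc⟩ := UnitDisc.hasBasis_cocompact.mem_iff.1
      (hr.tendsto_norm.eventually_const_lt hc1)
    have hopen : IsOpen ({w : ℂ | ‖r.num.eval w‖ < c * ‖r.denom.eval w‖} ∩ {w | ρ < ‖w‖}) :=
      (isOpen_lt r.num.continuous.norm (continuous_const.mul r.denom.continuous.norm)).inter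
        (isOpen_lt continuous_const continuous_norm)
    obtain ⟨w, ⟨hw1, hw2⟩, hw⟩ := mem_closure_iff.1 hcl _ hopen ⟨hc, by simpa [hz] using hρ⟩
    rw [mem_ball_zero_iff] at hw
    have h1 : c < ‖ratValue r w‖ := hρc (show UnitDisc.mk w hw ∈ {z : 𝔻 | ρ < ‖(z : ℂ)‖} from hw2)
    have h2 := hr.denom_ne_zero (UnitDisc.mk w hw)
    rw [UnitDisc.coe_mk] at h2
    rw [RatFunc.ratValue_eq, norm_div, lt_div_iff₀ (norm_pos_iff.2 h2)] at h1
    exact lt_asymm h1 hw1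

/-- The reflection principle `r z * conj (r (1 / conj z)) = 1`, with denominators cleared. -/
theorem num_mul_reflect :
    r.num * (r.num.map (starRingEnd ℂ)).reflect (ratDegree r) =
      r.denom * (r.denom.map (starRingEnd ℂ)).reflect (ratDegree r) := by
  refine Polynomial.eq_of_infinite_eval_eq _ _ (Set.Infinite.mono (s := sphere (0 : ℂ) 1) ?_ ?_)
  · intro z hz
    rw [mem_sphere_zero_iff_norm] at hz
    have hz0 : z ≠ 0 := by rintro rfl; simp at hz
    have hconj : conj z = z⁻¹ := by
      rw [Complex.inv_def, Complex.normSq_eq_norm_sq, hz]; simp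
    have key : ∀ P : ℂ[X], P.natDegree ≤ ratDegree r →
        ((P.map (starRingEnd ℂ)).reflect (ratDegree r)).eval z * z⁻¹ ^ ratDegree r
          = conj (P.eval z) := by
      intro P hP
      rw [eval_reflect_map_conj hP hz0, ← hconj, Complex.conj_conj]
    have h1 := key r.num (le_max_left _ _)
    have h2 := key r.denom (le_max_right _ _)
    refine mul_right_cancel₀ (pow_ne_zero (ratDegree r) (inv_ne_zero hz0)) ?_
    rw [Polynomial.eval_mul, Polynomial.eval_mul, mul_assoc, mul_assoc, h1, h2,
      Complex.mul_conj, Complex.mul_conj, Complex.normSq_eq_norm_sq, Complex.normSq_eq_norm_sq,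
      hr.norm_num_eq hz]
  · refine (isPreconnected_sphere (by simp) (0 : ℂ) 1).infinite_of_nontrivial ?_
    exact ⟨1, by simp, -1, by simp, by norm_num⟩

theorem norm_denom_lt {z : ℂ} (hz : 1 < ‖z‖) : ‖r.denom.eval z‖ < ‖r.num.eval z‖ := by
  have hz0 : z ≠ 0 := by rintro rfl; simp at hz; linarith
  have hw : ‖conj z⁻¹‖ < 1 := by
    rw [RCLike.norm_conj, norm_inv]; exact inv_lt_one_of_one_lt₀ hz
  have h := congrArg (fun P => P.eval z * z⁻¹ ^ ratDegree r) hr.num_mul_reflect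
  simp only [Polynomial.eval_mul, mul_assoc] at h
  rw [eval_reflect_map_conj (N := ratDegree r) (le_max_left _ _) hz0,
    eval_reflect_map_conj (N := ratDegree r) (le_max_right _ _) hz0] at h
  have h' := congrArg norm h
  simp only [norm_mul, RCLike.norm_conj] at h'
  have hlt := hr.norm_num_lt hw
  rcases eq_or_ne (r.denom.eval z) 0 with h0 | h0
  · rw [h0, norm_zero]
    refine norm_pos_iff.2 fun h1 => ?_
    obtain ⟨u, v, huv⟩ := r.isCoprime_num_denom
    have := congrArg (Polynomial.eval z) huv
    simp [h0, h1] at this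
  · have h0' := norm_pos_iff.2 h0
    by_contra hle
    rw [not_lt] at hle
    have hp : 0 ≤ ‖r.num.eval (conj z⁻¹)‖ := norm_nonneg _
    nlinarith

/-- The behaviour of `r` at infinity: it takes there a value outside of the closed disc. -/
theorem norm_coeff_denom_lt : ‖r.denom.coeff (ratDegree r)‖ < ‖r.num.coeff (ratDegree r)‖ := by
  have h := congrArg (Polynomial.eval 0) hr.num_mul_reflect
  simp only [Polynomial.eval_mul, ← Polynomial.coeff_zero_eq_eval_zero, Polynomial.coeff_reflect,
    Polynomial.revAt_le (Nat.zero_le _), Nat.sub_zero, Polynomial.coeff_map] at h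
  rw [Polynomial.coeff_zero_eq_eval_zero, Polynomial.coeff_zero_eq_eval_zero] at h
  have h' := congrArg norm h
  simp only [norm_mul, RCLike.norm_conj] at h'
  have hlt := hr.norm_num_lt (z := 0) (by simp)
  rcases eq_or_ne (r.denom.coeff (ratDegree r)) 0 with h0 | h0
  · rw [h0, norm_zero]
    refine norm_pos_iff.2 fun h1 => ?_
    rcases max_choice r.num.natDegree r.denom.natDegree with hm | hm
    · have hm' : ratDegree r = r.num.natDegree := hm
      rw [hm', Polynomial.coeff_natDegree, Polynomial.leadingCoeff_eq_zero] at h1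
      have h2 : r.denom.natDegree ≤ 0 := by
        have : r.denom.natDegree ≤ max r.num.natDegree r.denom.natDegree := le_max_right _ _
        rw [hm, h1] at this; simpa using this
      rw [hm', h1, Polynomial.natDegree_zero, ← Nat.le_zero.1 h2] at h0
      exact r.denom_ne_zero (Polynomial.leadingCoeff_eq_zero.1 h0)
    · have hm' : ratDegree r = r.denom.natDegree := hm
      rw [hm'] at h0
      exact r.denom_ne_zero (Polynomial.leadingCoeff_eq_zero.1 h0)
  · have h0' := norm_pos_iff.2 h0
    by_contra hle
    rw [not_lt] at hle
    have hp : 0 ≤ ‖r.num.eval 0‖ := norm_nonneg _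
    nlinarith

theorem natDegree_num_sub {ζ : ℂ} (hζ : ‖ζ‖ < 1) :
    (r.num - Polynomial.C ζ * r.denom).natDegree = ratDegree r := by
  refine Polynomial.natDegree_eq_of_le_of_coeff_ne_zero ?_ ?_
  · refine (Polynomial.natDegree_sub_le _ _).trans (max_le (le_max_left _ _) ?_)
    exact (Polynomial.natDegree_C_mul_le _ _).trans (le_max_right _ _)
  · rw [Polynomial.coeff_sub, Polynomial.coeff_C_mul]
    intro h
    have h1 := hr.norm_coeff_denom_lt
    rw [sub_eq_zero.1 h, norm_mul] at h1
    nlinarith [norm_nonneg (r.denom.coeff (ratDegree r))]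

theorem isRoot_num_sub_iff {ζ : ℂ} (hζ : ‖ζ‖ < 1) {z : ℂ} :
    (r.num - Polynomial.C ζ * r.denom).IsRoot z ↔ ‖z‖ < 1 ∧ ratValue r z = ζ := by
  rw [Polynomial.IsRoot.def, Polynomial.eval_sub, Polynomial.eval_mul, Polynomial.eval_C,
    sub_eq_zero]
  constructor
  · intro h
    have hd : r.denom.eval z ≠ 0 := by
      intro h0
      rw [h0, mul_zero] at h
      obtain ⟨u, v, huv⟩ := r.isCoprime_num_denom
      have := congrArg (Polynomial.eval z) huv
      simp [h0, h] at this
    refine ⟨?_, by rw [RatFunc.ratValue_eq, h, mul_div_cancel_right₀ _ hd]⟩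
    by_contra hz
    have h1 : ‖r.denom.eval z‖ ≤ ‖r.num.eval z‖ := by
      rcases (not_lt.1 hz).eq_or_lt with h1 | h1
      · exact (hr.norm_num_eq h1.symm).ge
      · exact (hr.norm_denom_lt h1).le
    rw [h, norm_mul] at h1
    nlinarith [norm_pos_iff.2 hd]
  · rintro ⟨hz, h⟩
    have hd := hr.denom_ne_zero (UnitDisc.mk z hz)
    rw [UnitDisc.coe_mk] at hd
    rw [← h, RatFunc.ratValue_eq, div_mul_cancel₀ _ hd]

theorem one_le_ratDegree : 1 ≤ ratDegree r := by
  by_contra h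
  have h0 : ratDegree r = 0 := by omega
  have h1 : r.num.natDegree = 0 := Nat.le_zero.1 (h0 ▸ le_max_left _ _)
  have h2 : r.denom.natDegree = 0 := Nat.le_zero.1 (h0 ▸ le_max_right _ _)
  have hc : ∀ z : 𝔻, ‖ratValue r z‖ = ‖ratValue r (0 : 𝔻)‖ := fun z => by
    rw [RatFunc.ratValue_eq, RatFunc.ratValue_eq, Polynomial.eq_C_of_natDegree_eq_zero h1,
      Polynomial.eq_C_of_natDegree_eq_zero h2]
    simp
  have h3 := hr.tendsto_norm.congr hc
  exact (hr.norm_lt_one 0).ne (tendsto_nhds_unique tendsto_const_nhds h3)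

theorem continuous : Continuous fun z : 𝔻 => UnitDisc.mk (ratValue r z) (hr.norm_lt_one z) := by
  rw [UnitDisc.isEmbedding_coe.continuous_iff]
  refine continuous_iff_continuousAt.2 fun z => ?_
  exact ContinuousAt.comp (f := ((↑) : 𝔻 → ℂ)) (g := ratValue r)
    (hasStrictDerivAt_ratValue (hr.denom_ne_zero z)).hasDerivAt.continuousAt
    UnitDisc.continuous_coe.continuousAt

/-- A rational function with unimodular boundary values is a Blaschke product. -/
noncomputable def toBlaschkeProduct : BlaschkeProduct where
  rat := r
  one_le_degree := hr.one_le_ratDegree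
  denom_ne_zero := hr.denom_ne_zero
  norm_value_lt_one := hr.norm_lt_one
  isProperMap := by
    refine isProperMap_iff_tendsto_cocompact.2 ⟨hr.continuous, ?_⟩
    exact UnitDisc.hasBasis_cocompact.tendsto_right_iff.2 fun ρ hρ =>
      hr.tendsto_norm.eventually_const_lt hρ
  surjective := by
    intro ζ
    obtain ⟨z, hz⟩ := IsAlgClosed.exists_root (r.num - Polynomial.C (ζ : ℂ) * r.denom) (by
      refine (Polynomial.natDegree_pos_iff_degree_pos.1 ?_).ne'
      rw [hr.natDegree_num_sub ζ.norm_lt_one]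
      exact hr.one_le_ratDegree)
    obtain ⟨hz1, hz2⟩ := (hr.isRoot_num_sub_iff ζ.norm_lt_one).1 hz
    exact ⟨UnitDisc.mk z hz1, UnitDisc.coe_injective hz2⟩

end IsInner

end RatFunc

/-! ### Blaschke products -/

namespace BlaschkeProduct

variable (A : BlaschkeProduct)

theorem continuous_toDisc : Continuous A.toDisc := A.isProperMap.continuous

theorem coe_toDisc (z : 𝔻) : (A.toDisc z : ℂ) = ratValue A.rat z := rfl

theorem tendsto_cocompact : Tendsto A.toDisc (cocompact 𝔻) (cocompact 𝔻) :=
  (isProperMap_iff_tendsto_cocompact.1 A.isProperMap).2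

theorem isInner : A.rat.IsInner where
  denom_ne_zero := A.denom_ne_zero
  norm_lt_one := A.norm_value_lt_one
  tendsto_norm := UnitDisc.tendsto_norm_cocompact.comp A.tendsto_cocompact

theorem hasValue (z : 𝔻) : A.rat.HasValue z (ratValue A.rat z) :=
  RatFunc.hasValue_ratValue (A.denom_ne_zero z)

theorem hasStrictDerivAt (z : 𝔻) :
    HasStrictDerivAt (ratValue A.rat) (deriv (ratValue A.rat) z) z := by
  have := RatFunc.hasStrictDerivAt_ratValue (A.denom_ne_zero z)
  rwa [this.hasDerivAt.deriv]

theorem deriv_eq_zero_iff (z : 𝔻) : deriv (ratValue A.rat) z = 0 ↔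
    A.rat.num.derivative.eval (z : ℂ) * A.rat.denom.eval (z : ℂ) -
      A.rat.num.eval (z : ℂ) * A.rat.denom.derivative.eval (z : ℂ) = 0 := by
  rw [(RatFunc.hasStrictDerivAt_ratValue (A.denom_ne_zero z)).hasDerivAt.deriv, div_eq_zero_iff,
    or_iff_left (pow_ne_zero 2 (A.denom_ne_zero z))]

/-- The points of the fibre over `ζ = p / q` are the zeros of the polynomial `p - ζ q`. -/
theorem mem_roots_iff (ζ : 𝔻) (z : ℂ) :
    z ∈ (A.rat.num - Polynomial.C (ζ : ℂ) * A.rat.denom).roots ↔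
      ∃ w : A.Fibre ζ, ((w : 𝔻) : ℂ) = z := by
  have hne : A.rat.num - Polynomial.C (ζ : ℂ) * A.rat.denom ≠ 0 := by
    intro h
    have := A.isInner.natDegree_num_sub ζ.norm_lt_one
    rw [h, Polynomial.natDegree_zero] at this
    have h1 := A.one_le_degree
    omega
  rw [Polynomial.mem_roots hne, A.isInner.isRoot_num_sub_iff ζ.norm_lt_one]
  constructor
  · rintro ⟨hz, h⟩
    exact ⟨⟨UnitDisc.mk z hz, UnitDisc.coe_injective h⟩, rfl⟩
  · rintro ⟨w, rfl⟩
    exact ⟨w.1.norm_lt_one, congrArg UnitDisc.coe w.2⟩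

/-- The fibre over `ζ` as the finite set of zeros of a polynomial. -/
noncomputable def fibreEquiv (ζ : 𝔻) :
    A.Fibre ζ ≃ (A.rat.num - Polynomial.C (ζ : ℂ) * A.rat.denom).roots.toFinset :=
  Equiv.ofBijective
    (fun w => ⟨((w : 𝔻) : ℂ), Multiset.mem_toFinset.2 ((A.mem_roots_iff ζ _).2 ⟨w, rfl⟩)⟩)
    ⟨fun w w' h => Subtype.ext (UnitDisc.coe_injective (Subtype.mk.inj h)), fun z => by
      obtain ⟨w, hw⟩ := (A.mem_roots_iff ζ _).1 (Multiset.mem_toFinset.1 z.2)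
      exact ⟨w, Subtype.ext hw⟩⟩

instance instFiniteFibre (ζ : 𝔻) : Finite (A.Fibre ζ) := Finite.of_equiv _ (A.fibreEquiv ζ).symm

theorem card_fibre_le (ζ : 𝔻) : Nat.card (A.Fibre ζ) ≤ A.degree := by
  rw [Nat.card_congr (A.fibreEquiv ζ), Nat.card_eq_fintype_card, Fintype.card_coe]
  refine (Multiset.toFinset_card_le _).trans ((Polynomial.card_roots' _).trans ?_)
  exact (A.isInner.natDegree_num_sub ζ.norm_lt_one).le

/-- At a regular value `ζ = p / q` the zeros of `p - ζ q` are simple. -/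
theorem card_fibre {ζ : 𝔻} (hζ : ζ ∉ A.criticalValues) : Nat.card (A.Fibre ζ) = A.degree := by
  rw [Nat.card_congr (A.fibreEquiv ζ), Nat.card_eq_fintype_card, Fintype.card_coe,
    Multiset.toFinset_card_of_nodup]
  · rw [IsAlgClosed.card_roots_eq_natDegree]
    exact A.isInner.natDegree_num_sub ζ.norm_lt_one
  · rw [Multiset.nodup_iff_count_le_one]
    intro z
    by_contra hcount
    rw [not_le, Polynomial.count_roots, Polynomial.one_lt_rootMultiplicity_iff_isRoot] at hcount
    · obtain ⟨h1, h2⟩ := hcount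
      obtain ⟨hz, hzζ⟩ := (A.isInner.isRoot_num_sub_iff ζ.norm_lt_one).1 h1
      refine hζ ⟨UnitDisc.mk z hz, UnitDisc.coe_injective hzζ, (A.deriv_eq_zero_iff _).2 ?_⟩
      simp only [Polynomial.IsRoot.def, Polynomial.eval_sub, Polynomial.eval_mul,
        Polynomial.eval_C, Polynomial.derivative_sub, Polynomial.derivative_C_mul,
        sub_eq_zero] at h1 h2
      rw [UnitDisc.coe_mk, h1, h2]
      ring
    · intro h
      have := A.isInner.natDegree_num_sub ζ.norm_lt_one
      rw [h, Polynomial.natDegree_zero] at this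
      have h1 := A.one_le_degree
      omega

theorem finite_deriv_eq_zero : {z : 𝔻 | deriv (ratValue A.rat) (z : ℂ) = 0}.Finite := by
  set W : ℂ[X] := A.rat.num.derivative * A.rat.denom - A.rat.num * A.rat.denom.derivative with hW
  have hW0 : W ≠ 0 := by
    intro h
    have hcop := A.rat.isCoprime_num_denom
    have h1 : A.rat.num ∣ A.rat.num.derivative :=
      hcop.dvd_of_dvd_mul_right ⟨_, sub_eq_zero.1 h⟩
    have h2 : A.rat.denom ∣ A.rat.denom.derivative :=
      hcop.symm.dvd_of_dvd_mul_left ⟨_, (sub_eq_zero.1 h).symm.trans (mul_comm _ _)⟩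
    have h3 : ∀ P : ℂ[X], P ∣ P.derivative → P.natDegree = 0 := fun P hP => by
      by_contra hne
      have h4 := Polynomial.eq_zero_of_dvd_of_degree_lt hP (Polynomial.degree_derivative_lt
        (by rintro rfl; simp at hne))
      exact hne (Polynomial.derivative_eq_zero.1 h4)
    have h5 : ratDegree A.rat = 0 := by
      rw [ratDegree, h3 _ h1, h3 _ h2, max_self]
    have := A.one_le_degree
    omega
  refine Set.Finite.subset ((W.roots.toFinset.finite_toSet).preimage
    UnitDisc.coe_injective.injOn) fun z hz => ?_
  have := (A.deriv_eq_zero_iff z).1 hz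
  simp only [mem_preimage, Finset.mem_coe, Multiset.mem_toFinset, Polynomial.mem_roots hW0]
  simpa [hW] using this

theorem finite_criticalValues : A.criticalValues.Finite := by
  refine (A.finite_deriv_eq_zero.image A.toDisc).subset ?_
  rintro w ⟨z, rfl, hz⟩
  exact ⟨z, hz, rfl⟩

theorem finite_preimage {S : Set 𝔻} (hS : S.Finite) : (A.toDisc ⁻¹' S).Finite :=
  hS.preimage' fun ζ _ => @Set.toFinite _ _ (A.instFiniteFibre ζ)

theorem finite_preimage_coe {S : Set ℂ} (hS : S.Finite) : {z : 𝔻 | (z : ℂ) ∈ S}.Finite :=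
  hS.preimage UnitDisc.coe_injective.injOn

/-- A holomorphic self-map of the disc with finitely many singularities and unimodular boundary
values is a Blaschke product. -/
theorem exists_eq_of_differentiableOn {S : Set ℂ} (hS : S.Finite) {f : ℂ → ℂ}
    (hd : DifferentiableOn ℂ f (ball 0 1 \ S)) (hlt : ∀ z : 𝔻, (z : ℂ) ∉ S → ‖f z‖ < 1)
    (ht : Tendsto (fun z : 𝔻 => ‖f z‖) (cocompact 𝔻) (𝓝 1)) :
    ∃ R : BlaschkeProduct, ∀ z : 𝔻, (z : ℂ) ∉ S → ratValue R.rat z = f z := by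
  obtain ⟨g, hg, hgf⟩ := exists_differentiableOn_ball_of_finite hS hd fun z hz =>
    (hlt (UnitDisc.mk z (mem_ball_zero_iff.1 hz.1)) hz.2).le
  have hev : ∀ᶠ z : 𝔻 in cocompact 𝔻, (z : ℂ) ∉ S :=
    (finite_preimage_coe hS).isCompact.compl_mem_cocompact
  have hgt : Tendsto (fun z : 𝔻 => ‖g z‖) (cocompact 𝔻) (𝓝 1) :=
    ht.congr' (hev.mono fun z hz => by simp only [hgf z ⟨z.coe_mem_ball, hz⟩])
  have hle : ∀ z ∈ ball (0 : ℂ) 1, ‖g z‖ ≤ 1 := fun z hz =>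
    norm_le_of_tendsto_norm_cocompact hg hgt (mem_ball_zero_iff.1 hz)
  obtain ⟨w, hw⟩ := hev.exists
  have hglt : ∀ z : 𝔻, ‖g z‖ < 1 := fun z => by
    refine lt_of_le_of_ne (hle z z.coe_mem_ball) fun h => ?_
    have := eqOn_of_isPreconnected_of_isMaxOn_norm (convex_ball (0 : ℂ) 1).isPreconnected
      isOpen_ball hg z.coe_mem_ball (isMaxOn_iff.2 fun v hv => by
        simpa [h] using hle v hv) w.coe_mem_ball
    rw [Function.const_apply, hgf w ⟨w.coe_mem_ball, hw⟩] at this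
    have h1 := hlt w hw
    rw [this, h] at h1
    exact lt_irrefl _ h1
  obtain ⟨P, Q, hPQ⟩ := exists_eq_div_of_tendsto_norm hg hgt
  have hval : ∀ z : 𝔻, (algebraMap ℂ[X] (RatFunc ℂ) P / algebraMap _ _ Q).HasValue z (g z) :=
    fun z => ⟨P, Q, (hPQ z z.coe_mem_ball).1, rfl, (hPQ z z.coe_mem_ball).2⟩
  have hin : (algebraMap ℂ[X] (RatFunc ℂ) P / algebraMap _ _ Q).IsInner :=
    { denom_ne_zero := fun z => (hval z).denom_ne_zero
      norm_lt_one := fun z => by rw [(hval z).ratValue_eq]; exact hglt z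
      tendsto_norm := hgt.congr fun z => by rw [(hval z).ratValue_eq] }
  exact ⟨hin.toBlaschkeProduct, fun z hz =>
    (hval z).ratValue_eq.trans (hgf z ⟨z.coe_mem_ball, hz⟩)⟩

theorem infinite_range_coe_compl {S : Set 𝔻} (hS : S.Finite) :
    {z : ℂ | ∃ w : 𝔻, w ∉ S ∧ (w : ℂ) = z}.Infinite := by
  have h : (range (UnitDisc.coe : 𝔻 → ℂ)).Infinite := by
    have : range (UnitDisc.coe : 𝔻 → ℂ) = ball 0 1 := Subtype.range_coe
    rw [this]
    exact infinite_of_mem_nhds 0 (ball_mem_nhds 0 one_pos)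
  refine (h.sdiff (hS.image UnitDisc.coe)).mono ?_
  rintro _ ⟨⟨w, rfl⟩, hw⟩
  exact ⟨w, fun hwS => hw ⟨w, hwS, rfl⟩, rfl⟩

/-- A composition identity between Blaschke products can be checked off a finite set. -/
theorem rat_eq_ratComp {A C A₁ : BlaschkeProduct} {S : Set 𝔻} (hS : S.Finite)
    (h : ∀ z ∉ S, A.toDisc z = C.toDisc (A₁.toDisc z)) : A.rat = ratComp C.rat A₁.rat := by
  refine RatFunc.eq_of_infinite_hasValue ((infinite_range_coe_compl hS).mono ?_)
  rintro _ ⟨z, hz, rfl⟩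
  refine ⟨_, A.hasValue z, ?_⟩
  rw [← coe_toDisc, h z hz]
  exact (A₁.hasValue z).ratComp (C.denom_ne_zero (A₁.toDisc z))

theorem toDisc_eq_of_ratComp {A C A₁ : BlaschkeProduct} (h : A.rat = ratComp C.rat A₁.rat)
    (z : 𝔻) : A.toDisc z = C.toDisc (A₁.toDisc z) := by
  refine UnitDisc.coe_injective ?_
  rw [coe_toDisc, h]
  exact ((A₁.hasValue z).ratComp (C.denom_ne_zero (A₁.toDisc z))).ratValue_eq

theorem deriv_of_ratComp {A C A₁ : BlaschkeProduct} (h : A.rat = ratComp C.rat A₁.rat) (z : 𝔻) :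
    deriv (ratValue A.rat) z =
      deriv (ratValue C.rat) (A₁.toDisc z) * deriv (ratValue A₁.rat) z := by
  have h1 : ratValue A.rat =ᶠ[𝓝 (z : ℂ)] ratValue C.rat ∘ ratValue A₁.rat := by
    filter_upwards [isOpen_ball.mem_nhds z.coe_mem_ball] with w hw
    exact congrArg UnitDisc.coe (toDisc_eq_of_ratComp h (UnitDisc.mk w (mem_ball_zero_iff.1 hw)))
  rw [h1.deriv_eq]
  exact ((C.hasStrictDerivAt (A₁.toDisc z)).hasDerivAt.comp (z : ℂ)
    (A₁.hasStrictDerivAt z).hasDerivAt).deriv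

end BlaschkeProduct

end InnerRationalFunctions

section Lifts

open Complex Filter Topology Metric Set
open scoped Complex.UnitDisc unitInterval

/-! ### Lifting of paths -/

namespace BlaschkeProduct

variable (A : BlaschkeProduct)

theorem isLocalHomeomorphOn_toDisc :
    IsLocalHomeomorphOn A.toDisc (A.toDisc ⁻¹' A.criticalValuesᶜ) := by
  have hcoe : IsLocalHomeomorph ((↑) : 𝔻 → ℂ) := UnitDisc.isOpenEmbedding_coe.isLocalHomeomorph
  have h : IsLocalHomeomorphOn (ratValue A.rat)
      (((↑) : 𝔻 → ℂ) '' (A.toDisc ⁻¹' A.criticalValuesᶜ)) := by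
    refine IsLocalHomeomorphOn.mk _ _ ?_
    rintro _ ⟨z, hz, rfl⟩
    have hz' : deriv (ratValue A.rat) (z : ℂ) ≠ 0 := fun h => hz ⟨z, rfl, h⟩
    have := (A.hasStrictDerivAt z).hasStrictFDerivAt_equiv hz'
    exact ⟨this.toOpenPartialHomeomorph _, this.mem_toOpenPartialHomeomorph_source,
      fun _ _ => rfl⟩
  exact IsLocalHomeomorphOn.of_comp_left (g := ((↑) : 𝔻 → ℂ)) (f := A.toDisc)
    (h.comp hcoe.isLocalHomeomorphOn (mapsTo_image _ _)) hcoe.isLocalHomeomorphOn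
    fun z _ => A.continuous_toDisc.continuousAt

/-- A Blaschke product is a covering of the set of its regular values. -/
theorem isCoveringMapOn_toDisc : IsCoveringMapOn A.toDisc A.criticalValuesᶜ :=
  A.isProperMap.isClosedMap.isCoveringMapOn_of_isLocalHomeomorphOn
    (fun ζ _ => A.finite_preimage (finite_singleton ζ)) A.isLocalHomeomorphOn_toDisc

/-- The path `γ` has a lift under `A` which leads from `z` to `z'`. -/
def Lifts {w w' : 𝔻} (γ : Path w w') (z z' : 𝔻) : Prop :=
  ∃ Γ : Path z z', ∀ t, A.toDisc (Γ t) = γ t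

variable {A} {w w' w'' z z' z'' : 𝔻} {γ : Path w w'}

theorem Lifts.toDisc_left (h : A.Lifts γ z z') : A.toDisc z = w := by
  obtain ⟨Γ, hΓ⟩ := h
  simpa using hΓ 0

theorem Lifts.toDisc_right (h : A.Lifts γ z z') : A.toDisc z' = w' := by
  obtain ⟨Γ, hΓ⟩ := h
  simpa using hΓ 1

theorem Lifts.symm (h : A.Lifts γ z z') : A.Lifts γ.symm z' z := by
  obtain ⟨Γ, hΓ⟩ := h
  exact ⟨Γ.symm, fun t => hΓ _⟩

theorem Lifts.trans {γ' : Path w' w''} (h : A.Lifts γ z z') (h' : A.Lifts γ' z' z'') :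
    A.Lifts (γ.trans γ') z z'' := by
  obtain ⟨Γ, hΓ⟩ := h
  obtain ⟨Γ', hΓ'⟩ := h'
  refine ⟨Γ.trans Γ', fun t => ?_⟩
  rw [Path.trans_apply, Path.trans_apply]
  split_ifs
  exacts [hΓ _, hΓ' _]

theorem exists_lifts (hγ : ∀ t, γ t ∉ A.criticalValues) (hz : A.toDisc z = w) :
    ∃ z', A.Lifts γ z z' := by
  have hcov := A.isCoveringMapOn_toDisc.isCoveringMap_restrictPreimage
  obtain ⟨Γ, hΓ, hΓ0⟩ := hcov.exists_path_lifts
    (⟨fun t => ⟨γ t, hγ t⟩, by fun_prop⟩ : C(I, (A.criticalValuesᶜ : Set 𝔻)))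
    ⟨z, by simpa [hz] using hγ 0⟩ (by ext; simp [hz])
  refine ⟨Γ 1, ⟨⟨⟨fun t => (Γ t : 𝔻), by fun_prop⟩, ?_, rfl⟩, fun t => ?_⟩⟩
  · simp [hΓ0]
  · exact congrArg Subtype.val (congrFun hΓ t)

theorem Lifts.right_unique (hγ : ∀ t, γ t ∉ A.criticalValues) (h : A.Lifts γ z z')
    (h' : A.Lifts γ z z'') : z' = z'' := by
  have hcov := A.isCoveringMapOn_toDisc.isCoveringMap_restrictPreimage
  obtain ⟨Γ, hΓ⟩ := h
  obtain ⟨Γ', hΓ'⟩ := h'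
  have hm : ∀ t, Γ t ∈ A.toDisc ⁻¹' A.criticalValuesᶜ := fun t => by
    rw [mem_preimage, hΓ t]; exact hγ t
  have hm' : ∀ t, Γ' t ∈ A.toDisc ⁻¹' A.criticalValuesᶜ := fun t => by
    rw [mem_preimage, hΓ' t]; exact hγ t
  have := hcov.eq_of_comp_eq (g₁ := fun t : I => ⟨Γ t, hm t⟩) (g₂ := fun t : I => ⟨Γ' t, hm' t⟩)
    (by fun_prop) (by fun_prop) (funext fun t => Subtype.ext ((hΓ t).trans (hΓ' t).symm)) 0
    (Subtype.ext (by simp))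
  simpa using congrArg Subtype.val (congrFun this 1)

theorem Lifts.left_unique (hγ : ∀ t, γ t ∉ A.criticalValues) (h : A.Lifts γ z z'')
    (h' : A.Lifts γ z' z'') : z = z' :=
  Lifts.right_unique (γ := γ.symm) (fun _ => hγ _) h.symm h'.symm

/-- A local inverse of `A` at a point which is not critical. -/
theorem exists_localSection (A : BlaschkeProduct) {z : 𝔻}
    (hz : deriv (ratValue A.rat) (z : ℂ) ≠ 0) :
    ∃ s : ℂ → ℂ, s (A.toDisc z) = z ∧
      HasDerivAt s (deriv (ratValue A.rat) (z : ℂ))⁻¹ (A.toDisc z) ∧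
      (∀ᶠ x in 𝓝 (z : ℂ), s (ratValue A.rat x) = x) ∧
      ∀ᶠ y in 𝓝 (A.toDisc z : ℂ), ContinuousAt s y ∧ ‖s y‖ < 1 ∧ ratValue A.rat (s y) = y := by
  have hd := (A.hasStrictDerivAt z).hasStrictFDerivAt_equiv hz
  set φ := hd.toOpenPartialHomeomorph (ratValue A.rat) with hφ
  have hsrc : (z : ℂ) ∈ φ.source := hd.mem_toOpenPartialHomeomorph_source
  have hcoe : ∀ x, φ x = ratValue A.rat x := fun x => rfl
  have htgt : (A.toDisc z : ℂ) ∈ φ.target := φ.map_source hsrc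
  have hleft : φ.symm (A.toDisc z) = z := φ.left_inv hsrc
  refine ⟨φ.symm, hleft, ?_, ?_, ?_⟩
  · exact φ.hasDerivAt_symm htgt hz (by rw [hleft]; exact (A.hasStrictDerivAt z).hasDerivAt)
  · filter_upwards [φ.open_source.mem_nhds hsrc] with x hx
    exact φ.left_inv hx
  · have hc : ContinuousAt φ.symm (A.toDisc z) := φ.continuousAt_symm htgt
    have hb : ∀ᶠ y in 𝓝 (A.toDisc z : ℂ), φ.symm y ∈ ball (0 : ℂ) 1 :=
      hc.eventually_mem (by rw [hleft]; exact isOpen_ball.mem_nhds z.coe_mem_ball)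
    filter_upwards [φ.open_target.mem_nhds htgt, hb] with y hy hyb
    exact ⟨φ.continuousAt_symm hy, mem_ball_zero_iff.1 hyb, φ.right_inv hy⟩

theorem lifts_of_section {s : ℂ → ℂ} {γ : Path w w'}
    (hs : ∀ t, ContinuousAt s (γ t) ∧ ‖s (γ t)‖ < 1 ∧ ratValue A.rat (s (γ t)) = γ t)
    (hz : (z : ℂ) = s w) (hz' : (z' : ℂ) = s w') : A.Lifts γ z z' := by
  refine ⟨⟨⟨fun t => UnitDisc.mk (s (γ t)) (hs t).2.1, ?_⟩, ?_, ?_⟩, fun t => ?_⟩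
  · rw [UnitDisc.isEmbedding_coe.continuous_iff]
    refine continuous_iff_continuousAt.2 fun t => ?_
    exact ContinuousAt.comp (f := fun t => (γ t : ℂ)) (hs t).1
      (UnitDisc.continuous_coe.comp γ.continuous).continuousAt
  · exact UnitDisc.coe_injective (by simp [hz])
  · exact UnitDisc.coe_injective (by simp [hz'])
  · exact UnitDisc.coe_injective (hs t).2.2

end BlaschkeProduct

theorem Complex.UnitDisc.exists_path_mem {V : Set ℂ} (hV : Convex ℝ V) (hVb : V ⊆ ball 0 1)
    {w w' : 𝔻} (hw : (w : ℂ) ∈ V) (hw' : (w' : ℂ) ∈ V) :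
    ∃ γ : Path w w', ∀ t, (γ t : ℂ) ∈ V := by
  obtain ⟨γ, hγ⟩ := (hV.isPathConnected ⟨_, hw⟩).joinedIn _ hw _ hw'
  refine ⟨⟨⟨fun t => UnitDisc.mk (γ t) (mem_ball_zero_iff.1 (hVb (hγ t))), ?_⟩, ?_, ?_⟩, hγ⟩
  · rw [UnitDisc.isEmbedding_coe.continuous_iff]
    exact γ.continuous
  · exact UnitDisc.coe_injective (by simp)
  · exact UnitDisc.coe_injective (by simp)

end Lifts

section Decomposable

open Complex Filter Topology Metric Set
open scoped Complex.UnitDisc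

/-! ### Monodromy of a pair with a common left factor -/

namespace BlaschkeProduct

variable {A C A₁ : BlaschkeProduct} (h : A.rat = ratComp C.rat A₁.rat)
include h

theorem Lifts.of_ratComp {w w' z z' : 𝔻} {γ : Path w w'} (hγ : A.Lifts γ z z') :
    C.Lifts γ (A₁.toDisc z) (A₁.toDisc z') := by
  obtain ⟨Γ, hΓ⟩ := hγ
  exact ⟨Γ.map A₁.continuous_toDisc, fun t => by
    rw [← hΓ t, toDisc_eq_of_ratComp h, Path.map_coe, Function.comp_apply]⟩

theorem criticalValues_subset_of_ratComp : C.criticalValues ⊆ A.criticalValues := by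
  rintro _ ⟨c, rfl, hc⟩
  obtain ⟨z, rfl⟩ := A₁.surjective c
  refine ⟨z, toDisc_eq_of_ratComp h z, ?_⟩
  rw [deriv_of_ratComp h]
  exact mul_eq_zero_of_left hc _

/-- The map from the fibre of `C ∘ A₁` to the fibre of `C` which `A₁` induces. -/
noncomputable def fibreMap {ζ : 𝔻} (z : A.Fibre ζ) : C.Fibre ζ :=
  ⟨A₁.toDisc z, (toDisc_eq_of_ratComp h _).symm.trans z.2⟩

theorem card_fibreMap_fibre {ζ : 𝔻} (hζ : ζ ∉ A.criticalValues) (c : C.Fibre ζ) :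
    Nat.card {z : A.Fibre ζ // fibreMap h z = c} = A₁.degree := by
  have hc : (c : 𝔻) ∉ A₁.criticalValues := by
    rintro ⟨z, hz, hz'⟩
    refine hζ ⟨z, ?_, ?_⟩
    · rw [toDisc_eq_of_ratComp h, hz, c.2]
    · rw [deriv_of_ratComp h]
      exact mul_eq_zero_of_right _ hz'
  rw [← A₁.card_fibre hc]
  refine Nat.card_congr ⟨fun z => ⟨z.1, congrArg Subtype.val z.2⟩,
    fun z => ⟨⟨z.1, ?_⟩, Subtype.ext z.2⟩, fun z => rfl, fun z => rfl⟩
  rw [toDisc_eq_of_ratComp h, z.2, c.2]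

theorem card_fibre_eq_mul {ζ : 𝔻} (hζ : ζ ∉ A.criticalValues) :
    Nat.card (A.Fibre ζ) = Nat.card (C.Fibre ζ) * A₁.degree := by
  have := Fintype.ofFinite (C.Fibre ζ)
  rw [Nat.card_congr (Equiv.sigmaFiberEquiv (fibreMap h)).symm, Nat.card_sigma,
    Finset.sum_congr rfl fun c _ => card_fibreMap_fibre h hζ c]
  simp

/-- With orderings for which `A₁ (a i) = B₁ (b i)`, the labels `γ_A^*(i)` and `γ_B^*(i)` belong to
points with the same image under `A₁`, namely the end point of a lift of `γ` under `C`. -/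
theorem exists_isNontrivialRel_of_ratComp {B B₁ : BlaschkeProduct} {d : ℕ} (hA : A.degree = d)
    (hB : B.degree = d) {ζ : 𝔻} (hζA : ζ ∉ A.criticalValues) (hζB : ζ ∉ B.criticalValues)
    (hC : 1 < C.degree) (h' : B.rat = ratComp C.rat B₁.rat) :
    ∃ (a : Fin d ≃ A.Fibre ζ) (b : Fin d ≃ B.Fibre ζ),
      IsNontrivialRel (monodromySetoid A B a b) := by
  have hζC : ζ ∉ C.criticalValues := fun hc => hζA (criticalValues_subset_of_ratComp h hc)
  have hdeg : A₁.degree = B₁.degree := by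
    have h1 := card_fibre_eq_mul h hζA
    have h2 := card_fibre_eq_mul h' hζB
    rw [A.card_fibre hζA, hA, C.card_fibre hζC] at h1
    rw [B.card_fibre hζB, hB, C.card_fibre hζC] at h2
    exact Nat.eq_of_mul_eq_mul_left (by omega) (h1.symm.trans h2)
  have he : ∀ c : C.Fibre ζ, Nonempty ({z : A.Fibre ζ // fibreMap h z = c} ≃
      {z : B.Fibre ζ // fibreMap h' z = c}) := fun c =>
    Finite.card_eq.1 (by rw [card_fibreMap_fibre h hζA, card_fibreMap_fibre h' hζB, hdeg])
  let e : A.Fibre ζ ≃ B.Fibre ζ := Equiv.ofFiberEquiv fun c => (he c).some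
  have hmap : ∀ z, B₁.toDisc (e z) = A₁.toDisc z := fun z =>
    congrArg Subtype.val (Equiv.ofFiberEquiv_map (fun c => (he c).some) z)
  let a : Fin d ≃ A.Fibre ζ :=
    (Finite.equivFinOfCardEq ((A.card_fibre hζA).trans hA)).symm
  refine ⟨a, a.trans e, fun htriv => ?_⟩
  have key : ∀ j k, monodromySetoid A B a (a.trans e) j k →
      A₁.toDisc (a j) = A₁.toDisc (a k) := by
    intro j k hjk
    induction hjk with
    | refl => rfl
    | symm _ _ _ ih => exact ih.symm
    | trans _ _ _ _ _ ih ih' => exact ih.trans ih'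
    | rel j k hjk =>
      have aux : ∀ (γ : Path ζ ζ) (i j k : Fin d), (∀ t, γ t ∉ C.criticalValues) →
          B.MonodromySends (a.trans e) γ i j → A.MonodromySends a γ i k →
          A₁.toDisc (a j) = A₁.toDisc (a k) := by
        intro γ i j k hγ h1 h2
        have h1' := Lifts.of_ratComp h' (γ := γ) h1
        simp only [Equiv.trans_apply, hmap] at h1'
        exact h1'.right_unique hγ (Lifts.of_ratComp h (γ := γ) h2)
      obtain ⟨γ, hγ, i, h1 | h1⟩ := hjk
      · exact aux γ i j k (fun t hc => (hγ t).1 (criticalValues_subset_of_ratComp h hc)) h1.1 h1.2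
      · exact (aux γ i k j
          (fun t hc => (hγ t).1 (criticalValues_subset_of_ratComp h hc)) h1.1 h1.2).symm
  rw [← C.card_fibre hζC, Finite.one_lt_card_iff_nontrivial] at hC
  obtain ⟨c, c', hcc⟩ := hC
  have hsurj : ∀ c : C.Fibre ζ, ∃ j, A₁.toDisc (a j) = c := fun c => by
    obtain ⟨z, hz⟩ := A₁.surjective c
    exact ⟨a.symm ⟨z, by rw [toDisc_eq_of_ratComp h]; exact (congrArg C.toDisc hz).trans c.2⟩,
      by rw [Equiv.apply_symm_apply]; exact hz⟩
  obtain ⟨j, hj⟩ := hsurj c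
  obtain ⟨k, hk⟩ := hsurj c'
  exact hcc (Subtype.ext (hj.symm.trans ((key j k (htriv j k)).trans hk)))

end BlaschkeProduct

end Decomposable

section Transport

open Complex Filter Topology Metric Set
open scoped Complex.UnitDisc

/-! ### Transport of the labels along paths -/

namespace BlaschkeProduct

variable {A B : BlaschkeProduct} {d : ℕ} {ζ : 𝔻} {a : Fin d ≃ A.Fibre ζ} {b : Fin d ≃ B.Fibre ζ}

theorem exists_monodromySends (a : Fin d ≃ A.Fibre ζ) {γ : Path ζ ζ}
    (hγ : ∀ t, γ t ∉ A.criticalValues) (i : Fin d) : ∃ j, A.MonodromySends a γ i j := by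
  obtain ⟨z, hz⟩ := exists_lifts hγ (a i).2
  refine ⟨a.symm ⟨z, hz.toDisc_right⟩, ?_⟩
  have : A.Lifts γ (a i : 𝔻) (a (a.symm ⟨z, hz.toDisc_right⟩) : 𝔻) := by
    rwa [Equiv.apply_symm_apply]
  exact this

theorem MonodromySends.right_unique {γ : Path ζ ζ} (hγ : ∀ t, γ t ∉ A.criticalValues)
    {i j k : Fin d} (h : A.MonodromySends a γ i j) (h' : A.MonodromySends a γ i k) : j = k :=
  a.injective (Subtype.ext (Lifts.right_unique hγ h h'))

theorem rel_of_sends {γ : Path ζ ζ} (hγ : ∀ t, γ t ∉ A.criticalValues ∧ γ t ∉ B.criticalValues)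
    {i j k : Fin d} (hj : A.MonodromySends a γ i j) (hk : B.MonodromySends b γ i k) :
    monodromySetoid A B a b j k :=
  .rel _ _ ⟨γ, hγ, i, .inr ⟨hk, hj⟩⟩

/-- The monodromy of `A` permutes the classes of `∼`: if `i = σ_B^*(l)` and `j = σ_A^*(l)`, then
`γ_A^*(i) ∼ γ_B^*(i) = (σγ)_B^*(l) ∼ (σγ)_A^*(l) = γ_A^*(j)`. -/
theorem rel_of_sends_of_rel {γ : Path ζ ζ}
    (hγ : ∀ t, γ t ∉ A.criticalValues ∧ γ t ∉ B.criticalValues) {i j i' j' : Fin d}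
    (hi : A.MonodromySends a γ i i') (hj : A.MonodromySends a γ j j')
    (h : monodromySetoid A B a b i j) : monodromySetoid A B a b i' j' := by
  choose f hf using exists_monodromySends a fun t => (hγ t).1
  choose g hg using exists_monodromySends b fun t => (hγ t).2
  have aux : ∀ (σ : Path ζ ζ), (∀ t, σ t ∉ A.criticalValues ∧ σ t ∉ B.criticalValues) →
      ∀ l i j, B.MonodromySends b σ l i → A.MonodromySends a σ l j →
      monodromySetoid A B a b (f i) (f j) := by
    intro σ hσ l i j hi hj
    have hA : A.MonodromySends a (σ.trans γ) l (f j) := Lifts.trans hj (hf j)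
    have hB : B.MonodromySends b (σ.trans γ) l (g i) := Lifts.trans hi (hg i)
    have hgood : ∀ t, (σ.trans γ) t ∉ A.criticalValues ∧ (σ.trans γ) t ∉ B.criticalValues := by
      intro t
      rw [Path.trans_apply]
      split_ifs
      exacts [hσ _, hγ _]
    exact Setoid.trans' _ (rel_of_sends hγ (hf i) (hg i))
      (Setoid.symm' _ (rel_of_sends hgood hA hB))
  have key : ∀ i j, monodromySetoid A B a b i j → monodromySetoid A B a b (f i) (f j) := by
    intro i j h
    induction h with
    | refl => exact Setoid.refl' _ _
    | symm _ _ _ ih => exact Setoid.symm' _ ih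
    | trans _ _ _ _ _ ih ih' => exact Setoid.trans' _ ih ih'
    | rel i j h =>
      obtain ⟨σ, hσ, l, h | h⟩ := h
      · exact aux σ hσ l i j h.1 h.2
      · exact Setoid.symm' _ (aux σ hσ l j i h.1 h.2)
  rw [hi.right_unique (fun t => (hγ t).1) (hf i), hj.right_unique (fun t => (hγ t).1) (hf j)]
  exact key i j h

/-- The labellings `zs` of `A⁻¹(w)` and `ys` of `B⁻¹(w)` arise from `a` and `b` by lifting one path
from `ζ` to `w` which avoids the critical values. -/
def IsTransport (a : Fin d ≃ A.Fibre ζ) (b : Fin d ≃ B.Fibre ζ) (w : 𝔻) (zs ys : Fin d → 𝔻) :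
    Prop :=
  ∃ γ : Path ζ w, (∀ t, γ t ∉ A.criticalValues ∧ γ t ∉ B.criticalValues) ∧
    (∀ j, A.Lifts γ (a j) (zs j)) ∧ ∀ j, B.Lifts γ (b j) (ys j)

theorem isTransport_self (a : Fin d ≃ A.Fibre ζ) (b : Fin d ≃ B.Fibre ζ)
    (hζA : ζ ∉ A.criticalValues) (hζB : ζ ∉ B.criticalValues) :
    IsTransport a b ζ (fun j => a j) (fun j => b j) :=
  ⟨Path.refl ζ, fun _ => ⟨hζA, hζB⟩, fun j => ⟨Path.refl _, fun _ => (a j).2⟩,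
    fun j => ⟨Path.refl _, fun _ => (b j).2⟩⟩

theorem exists_isTransport (a : Fin d ≃ A.Fibre ζ) (b : Fin d ≃ B.Fibre ζ)
    (hζA : ζ ∉ A.criticalValues) (hζB : ζ ∉ B.criticalValues) {w : 𝔻}
    (hw : w ∉ A.criticalValues ∪ B.criticalValues) : ∃ zs ys, IsTransport a b w zs ys := by
  obtain ⟨γ, hγ⟩ := (UnitDisc.isPathConnected_compl
    (A.finite_criticalValues.union B.finite_criticalValues)).joinedIn ζ
    (fun h => h.elim hζA hζB) w hw
  have hγ' : ∀ t, γ t ∉ A.criticalValues ∧ γ t ∉ B.criticalValues := fun t =>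
    not_or.1 (hγ t)
  choose zs hzs using fun j => exists_lifts (fun t => (hγ' t).1) (a j).2
  choose ys hys using fun j => exists_lifts (fun t => (hγ' t).2) (b j).2
  exact ⟨zs, ys, γ, hγ', hzs, hys⟩

theorem exists_eq_of_lifts {w : 𝔻} {γ : Path ζ w} (hγ : ∀ t, γ t ∉ A.criticalValues)
    {zs : Fin d → 𝔻} (hzs : ∀ j, A.Lifts γ (a j) (zs j)) {z : 𝔻} (hz : A.toDisc z = w) :
    ∃ j, zs j = z := by
  obtain ⟨x, hx⟩ := exists_lifts (γ := γ.symm) (fun t => hγ _) hz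
  refine ⟨a.symm ⟨x, hx.toDisc_right⟩, ?_⟩
  have h := hzs (a.symm ⟨x, hx.toDisc_right⟩)
  rw [Equiv.apply_symm_apply] at h
  exact h.right_unique hγ (by simpa using hx.symm)

section

variable {w : 𝔻} {zs ys zs' ys' : Fin d → 𝔻} (h : IsTransport a b w zs ys)
include h

theorem IsTransport.toDisc_left (j : Fin d) : A.toDisc (zs j) = w := by
  obtain ⟨γ, -, h, -⟩ := h
  exact (h j).toDisc_right

theorem IsTransport.toDisc_right (j : Fin d) : B.toDisc (ys j) = w := by
  obtain ⟨γ, -, -, h⟩ := h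
  exact (h j).toDisc_right

theorem IsTransport.notMem : w ∉ A.criticalValues ∧ w ∉ B.criticalValues := by
  obtain ⟨γ, h, -, -⟩ := h
  simpa using h 1

theorem IsTransport.exists_left {z : 𝔻} (hz : A.toDisc z = w) : ∃ j, zs j = z := by
  obtain ⟨γ, hγ, h, -⟩ := h
  exact exists_eq_of_lifts (fun t => (hγ t).1) h hz

theorem IsTransport.exists_right {y : 𝔻} (hy : B.toDisc y = w) : ∃ j, ys j = y := by
  obtain ⟨γ, hγ, -, h⟩ := h
  exact exists_eq_of_lifts (fun t => (hγ t).2) h hy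

theorem IsTransport.injective_left : Function.Injective zs := by
  obtain ⟨γ, hγ, h, -⟩ := h
  intro i j hij
  have hj := h j
  rw [← hij] at hj
  exact a.injective (Subtype.ext ((h i).left_unique (fun t => (hγ t).1) hj))

/-- Two transports to the same point differ by the monodromy of a loop, which acts in the same way
on the classes of labels for `A` and for `B`. -/
theorem IsTransport.exists_perm (h' : IsTransport a b w zs' ys') :
    ∃ f : Fin d ≃ Fin d, (∀ j, zs' (f j) = zs j) ∧
      (∀ i j, monodromySetoid A B a b i j ↔ monodromySetoid A B a b (f i) (f j)) ∧
      ∀ i j, ys' j = ys i → monodromySetoid A B a b (f i) j := by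
  choose f hf using fun j => h'.exists_left (h.toDisc_left j)
  have hinj : Function.Injective f := fun i j hij =>
    h.injective_left (by rw [← hf i, ← hf j, hij])
  obtain ⟨γ, hγ, hz, hy⟩ := h
  obtain ⟨γ', hγ', hz', hy'⟩ := h'
  have hgood : ∀ t, (γ.trans γ'.symm) t ∉ A.criticalValues ∧
      (γ.trans γ'.symm) t ∉ B.criticalValues := by
    intro t
    rw [Path.trans_apply]
    split_ifs
    exacts [hγ _, hγ' _]
  have hgood' : ∀ t, (γ.trans γ'.symm).symm t ∉ A.criticalValues ∧
      (γ.trans γ'.symm).symm t ∉ B.criticalValues := fun t => hgood _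
  have hs : ∀ j, A.MonodromySends a (γ.trans γ'.symm) j (f j) := fun j => by
    have := hz' (f j)
    rw [hf j] at this
    exact Lifts.trans (hz j) this.symm
  have hs' : ∀ j, A.MonodromySends a (γ.trans γ'.symm).symm (f j) j := fun j =>
    Lifts.symm (hs j)
  refine ⟨Equiv.ofBijective f (Finite.injective_iff_bijective.1 hinj), hf, fun i j => ?_,
    fun i j hij => ?_⟩
  · exact ⟨rel_of_sends_of_rel hgood (hs i) (hs j), rel_of_sends_of_rel hgood' (hs' i) (hs' j)⟩
  · have := hy' j
    rw [hij] at this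
    exact rel_of_sends hgood (hs i) (Lifts.trans (hy i) this.symm)

end

open Classical in
/-- The product of the values of `φ` at the points of `zs` with label in the class of `i`. -/
noncomputable def classProd (s : Setoid (Fin d)) (φ : ℂ → ℂ) (zs : Fin d → 𝔻) (i : Fin d) : ℂ :=
  ∏ j with s i j, φ (zs j)

theorem classProd_congr {s : Setoid (Fin d)} {φ : ℂ → ℂ} {zs : Fin d → 𝔻} {i j : Fin d}
    (h : s i j) : classProd s φ zs i = classProd s φ zs j := by
  classical
  refine Finset.prod_congr (Finset.filter_congr fun k _ => ?_) fun _ _ => rfl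
  exact ⟨fun hk => s.trans' (s.symm' h) hk, fun hk => s.trans' h hk⟩

theorem IsTransport.classProd_eq {w : 𝔻} {zs ys zs' ys' : Fin d → 𝔻} (φ : ℂ → ℂ)
    (h : IsTransport a b w zs ys) (h' : IsTransport a b w zs' ys') :
    (∀ i j, zs i = zs' j → classProd (monodromySetoid A B a b) φ zs i =
      classProd (monodromySetoid A B a b) φ zs' j) ∧
    ∀ i j, ys i = ys' j → classProd (monodromySetoid A B a b) φ zs i =
      classProd (monodromySetoid A B a b) φ zs' j := by
  classical
  obtain ⟨f, hf, hrel, hy⟩ := h.exists_perm h'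
  have key : ∀ i, classProd (monodromySetoid A B a b) φ zs i =
      classProd (monodromySetoid A B a b) φ zs' (f i) := fun i => by
    refine Finset.prod_equiv f (fun j => ?_) fun j _ => by rw [hf]
    simpa using hrel i j
  refine ⟨fun i j hij => ?_, fun i j hij => ?_⟩
  · rw [key, h'.injective_left ((hf i).trans hij)]
  · rw [key, classProd_congr (hy i j hij.symm)]

/-- There are functions on the regular points of `A` and of `B` whose common value, at points with
the same label, is the product of `φ` over the block of `A⁻¹(w)` with that label. -/
theorem exists_blockFunctions (a : Fin d ≃ A.Fibre ζ) (b : Fin d ≃ B.Fibre ζ) (φ : ℂ → ℂ) :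
    ∃ F G : 𝔻 → ℂ, ∀ w zs ys, IsTransport a b w zs ys → ∀ i,
      F (zs i) = classProd (monodromySetoid A B a b) φ zs i ∧
      G (ys i) = classProd (monodromySetoid A B a b) φ zs i := by
  let P : 𝔻 → ℂ → Prop := fun z v => ∃ w zs ys i, IsTransport a b w zs ys ∧ zs i = z ∧
    classProd (monodromySetoid A B a b) φ zs i = v
  let Q : 𝔻 → ℂ → Prop := fun z v => ∃ w zs ys i, IsTransport a b w zs ys ∧ ys i = z ∧
    classProd (monodromySetoid A B a b) φ zs i = v
  refine ⟨fun z => Classical.epsilon (P z), fun z => Classical.epsilon (Q z),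
    fun w zs ys h i => ⟨?_, ?_⟩⟩
  · obtain ⟨w', zs', ys', i', h', hi, hv⟩ :=
      Classical.epsilon_spec (p := P (zs i)) ⟨_, w, zs, ys, i, h, rfl, rfl⟩
    obtain rfl : w = w' := by rw [← h.toDisc_left i, ← h'.toDisc_left i', hi]
    exact hv.symm.trans ((h'.classProd_eq φ h).1 i' i hi)
  · obtain ⟨w', zs', ys', i', h', hi, hv⟩ :=
      Classical.epsilon_spec (p := Q (ys i)) ⟨_, w, zs, ys, i, h, rfl, rfl⟩
    obtain rfl : w = w' := by rw [← h.toDisc_right i, ← h'.toDisc_right i', hi]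
    exact hv.symm.trans ((h'.classProd_eq φ h).2 i' i hi)

/-- Near a point `w`, labels are transported by local sections of `A` and `B`. -/
theorem IsTransport.exists_localSections {w : 𝔻} {zs ys : Fin d → 𝔻}
    (h : IsTransport a b w zs ys) :
    ∃ s : Fin d → ℂ → ℂ, (∀ j, s j w = zs j) ∧
      (∀ j, HasDerivAt (s j) (deriv (ratValue A.rat) (zs j))⁻¹ w) ∧
      ∀ i, (∀ᶠ z : 𝔻 in 𝓝 (zs i), ∃ zs' ys', IsTransport a b (A.toDisc z) zs' ys' ∧ zs' i = z ∧
          ∀ j, (zs' j : ℂ) = s j (A.toDisc z)) ∧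
        ∀ᶠ y : 𝔻 in 𝓝 (ys i), ∃ zs' ys', IsTransport a b (B.toDisc y) zs' ys' ∧ ys' i = y ∧
          ∀ j, (zs' j : ℂ) = s j (B.toDisc y) := by
  have hA : ∀ j, deriv (ratValue A.rat) (zs j : ℂ) ≠ 0 := fun j h0 =>
    h.notMem.1 ⟨zs j, h.toDisc_left j, h0⟩
  have hB : ∀ j, deriv (ratValue B.rat) (ys j : ℂ) ≠ 0 := fun j h0 =>
    h.notMem.2 ⟨ys j, h.toDisc_right j, h0⟩
  choose s hs0 hsd hsl hsr using fun j => exists_localSection A (hA j)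
  choose t ht0 htd htl htr using fun j => exists_localSection B (hB j)
  simp only [h.toDisc_left] at hs0 hsd hsr
  simp only [h.toDisc_right] at ht0 htd htr
  have hU : ∀ᶠ y in 𝓝 (w : ℂ), y ∈ ball (0 : ℂ) 1 ∧
      y ∉ UnitDisc.coe '' (A.criticalValues ∪ B.criticalValues) := by
    refine (isOpen_ball.eventually_mem w.coe_mem_ball).and ?_
    refine (((A.finite_criticalValues.union B.finite_criticalValues).image
      UnitDisc.coe).isClosed.isOpen_compl).eventually_mem ?_
    rintro ⟨x, hx, hxw⟩
    rw [UnitDisc.coe_injective hxw] at hx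
    exact hx.elim h.notMem.1 h.notMem.2
  obtain ⟨ε, hε, hball⟩ := Metric.eventually_nhds_iff_ball.1
    (hU.and ((eventually_all.2 hsr).and (eventually_all.2 htr)))
  have key : ∀ x : 𝔻, (x : ℂ) ∈ ball (w : ℂ) ε → ∃ zs' ys', IsTransport a b x zs' ys' ∧
      (∀ j, (zs' j : ℂ) = s j x) ∧ ∀ j, (ys' j : ℂ) = t j x := by
    intro x hx
    obtain ⟨δ, hδ⟩ := UnitDisc.exists_path_mem (convex_ball (w : ℂ) ε)
      (fun y hy => (hball y hy).1.1) (mem_ball_self hε) hx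
    refine ⟨fun j => UnitDisc.mk (s j x) ((hball x hx).2.1 j).2.1,
      fun j => UnitDisc.mk (t j x) ((hball x hx).2.2 j).2.1, ?_, fun j => rfl, fun j => rfl⟩
    obtain ⟨γ, hγ, hz, hy⟩ := h
    refine ⟨γ.trans δ, fun u => ?_, fun j => (hz j).trans ?_, fun j => (hy j).trans ?_⟩
    · rw [Path.trans_apply]
      split_ifs
      · exact hγ _
      · exact not_or.1 fun hu => (hball _ (hδ _)).1.2 ⟨_, hu, rfl⟩
    · exact lifts_of_section (fun u => (hball _ (hδ u)).2.1 j) (hs0 j).symm rfl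
    · exact lifts_of_section (fun u => (hball _ (hδ u)).2.2 j) (ht0 j).symm rfl
  refine ⟨s, hs0, hsd, fun i => ⟨?_, ?_⟩⟩
  · have h1 : ∀ᶠ z : 𝔻 in 𝓝 (zs i), (A.toDisc z : ℂ) ∈ ball (w : ℂ) ε :=
      (UnitDisc.continuous_coe.comp A.continuous_toDisc).continuousAt.eventually_mem
        (by simpa [h.toDisc_left i] using ball_mem_nhds (w : ℂ) hε)
    filter_upwards [h1, UnitDisc.continuous_coe.continuousAt.eventually (hsl i)] with z hz hzs
    obtain ⟨zs', ys', h', hzs', -⟩ := key _ hz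
    exact ⟨zs', ys', h', UnitDisc.coe_injective ((hzs' i).trans hzs), hzs'⟩
  · have h1 : ∀ᶠ y : 𝔻 in 𝓝 (ys i), (B.toDisc y : ℂ) ∈ ball (w : ℂ) ε :=
      (UnitDisc.continuous_coe.comp B.continuous_toDisc).continuousAt.eventually_mem
        (by simpa [h.toDisc_right i] using ball_mem_nhds (w : ℂ) hε)
    filter_upwards [h1, UnitDisc.continuous_coe.continuousAt.eventually (htl i)] with y hy hyt
    obtain ⟨zs', ys', h', hzs', hys'⟩ := key _ hy
    exact ⟨zs', ys', h', UnitDisc.coe_injective ((hys' i).trans hyt), hzs'⟩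

end BlaschkeProduct

end Transport

section Construction

open Complex Filter Topology Metric Set
open scoped Complex.UnitDisc

/-! ### Construction of the factors -/

theorem Complex.UnitDisc.dense_compl {S : Set 𝔻} (hS : S.Finite) : Dense Sᶜ := by
  intro z
  rw [mem_closure_iff_nhds]
  intro V hV
  have h1 : UnitDisc.coe '' V ∈ 𝓝 (z : ℂ) := UnitDisc.isOpenEmbedding_coe.image_mem_nhds.2 hV
  by_contra h
  rw [not_nonempty_iff_eq_empty, ← disjoint_iff_inter_eq_empty, disjoint_compl_right_iff] at h
  exact infinite_of_mem_nhds _ h1 ((hS.subset h).image _)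

theorem norm_sub_le_two_mul_norm_discMobius {a z : ℂ} (ha : ‖a‖ < 1) (hz : ‖z‖ < 1) :
    ‖z - a‖ ≤ 2 * ‖discMobius a z‖ := by
  have h0 := norm_pos_iff.2 (one_sub_conj_mul_ne_zero ha hz)
  have h1 : ‖1 - (starRingEnd ℂ) a * z‖ ≤ 2 := by
    refine (norm_sub_le _ _).trans ?_
    rw [norm_one, norm_mul, RCLike.norm_conj]
    nlinarith [norm_nonneg a, norm_nonneg z]
  have h2 : ‖z - a‖ = ‖discMobius a z‖ * ‖1 - (starRingEnd ℂ) a * z‖ := by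
    rw [discMobius, norm_div, div_mul_cancel₀ _ h0.ne']
  rw [h2]
  nlinarith [norm_nonneg (discMobius a z)]

open Classical in
/-- A function on the disc as a function on `ℂ`, with value `0` off the disc. -/
noncomputable def Complex.UnitDisc.extend (F : 𝔻 → ℂ) (x : ℂ) : ℂ :=
  if h : ‖x‖ < 1 then F (Complex.UnitDisc.mk x h) else 0

theorem Complex.UnitDisc.extend_coe (F : 𝔻 → ℂ) (z : 𝔻) : UnitDisc.extend F z = F z := by
  simp [UnitDisc.extend, z.norm_lt_one]

theorem Complex.UnitDisc.extend_eventuallyEq {F : 𝔻 → ℂ} {g : ℂ → ℂ} {z : 𝔻}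
    (h : ∀ᶠ x : 𝔻 in 𝓝 z, F x = g x) : UnitDisc.extend F =ᶠ[𝓝 (z : ℂ)] g := by
  rw [← UnitDisc.isOpenEmbedding_coe.map_nhds_eq z]
  exact eventually_map.2 (h.mono fun x hx => (UnitDisc.extend_coe F x).trans hx)

theorem tendsto_one_of_forall_lt {α : Type*} {l : Filter α} {f : α → ℝ} (h1 : ∀ᶠ x in l, f x ≤ 1)
    (h : ∀ c < 1, ∀ᶠ x in l, c < f x) : Tendsto f l (𝓝 1) :=
  tendsto_order.2 ⟨h, fun _ hc => h1.mono fun _ hx => hx.trans_lt hc⟩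

namespace BlaschkeProduct

variable {A B : BlaschkeProduct} {d : ℕ} {ζ : 𝔻} {a : Fin d ≃ A.Fibre ζ} {b : Fin d ≃ B.Fibre ζ}

theorem mem_block {s : Setoid (Fin d)} {i : Fin d} [DecidablePred (s i)] :
    i ∈ (Finset.univ.filter (s i) : Finset (Fin d)) := by
  simp

theorem classProd_eq_zero_iff {s : Setoid (Fin d)} {φ : ℂ → ℂ} {zs : Fin d → 𝔻} {i : Fin d} :
    classProd s φ zs i = 0 ↔ ∃ j, s i j ∧ φ (zs j) = 0 := by
  classical
  simp [classProd, Finset.prod_eq_zero_iff]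

theorem pow_le_norm_classProd {s : Setoid (Fin d)} {φ : ℂ → ℂ} {zs : Fin d → 𝔻} {i : Fin d}
    {e : ℝ} (he0 : 0 ≤ e) (he1 : e ≤ 1) (h : ∀ j, e ≤ ‖φ (zs j)‖) :
    e ^ d ≤ ‖classProd s φ zs i‖ := by
  classical
  have hcard : (Finset.univ.filter (s i)).card ≤ d :=
    (Finset.card_le_univ _).trans (Fintype.card_fin d).le
  refine (pow_le_pow_of_le_one he0 he1 hcard).trans ?_
  rw [classProd, norm_prod, ← Finset.prod_const]
  exact Finset.prod_le_prod (fun _ _ => he0) fun j _ => h j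

/-- A function which is holomorphic on the regular points of `X`, and at such a point `y` a product
of values of a Möbius transformation over points of the fibre `A⁻¹(X y)`, is a Blaschke product. -/
theorem exists_eq_of_blockProduct (X : BlaschkeProduct) {S : Set 𝔻} (hS : S.Finite) (p : 𝔻)
    {F : 𝔻 → ℂ} (s : Setoid (Fin d))
    (hF : ∀ y, X.toDisc y ∉ S → ∃ (zs : Fin d → 𝔻) (i : Fin d),
      (∀ j, A.toDisc (zs j) = X.toDisc y) ∧ F y = classProd s (discMobius p) zs i)
    (hd : ∀ y, X.toDisc y ∉ S → DifferentiableAt ℂ (UnitDisc.extend F) y) :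
    ∃ R : BlaschkeProduct, ∀ y, X.toDisc y ∉ S → ratValue R.rat y = F y := by
  classical
  have hT : (X.toDisc ⁻¹' S).Finite := X.finite_preimage hS
  have hle : ∀ y, X.toDisc y ∉ S → ‖F y‖ < 1 := fun y hy => by
    obtain ⟨zs, i, -, hFy⟩ := hF y hy
    rw [hFy, classProd, norm_prod, ← Finset.mul_prod_erase _ _ (mem_block (s := s) (i := i))]
    refine mul_lt_one_of_nonneg_of_lt_one_left (norm_nonneg _)
      (norm_discMobius_lt_one p.norm_lt_one (zs i).norm_lt_one) ?_
    exact Finset.prod_le_one (fun _ _ => norm_nonneg _) fun j _ =>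
      (norm_discMobius_lt_one p.norm_lt_one (zs j).norm_lt_one).le
  obtain ⟨R, hR⟩ := exists_eq_of_differentiableOn (S := UnitDisc.coe '' (X.toDisc ⁻¹' S))
    (hT.image _) (f := UnitDisc.extend F) (fun x hx => by
      have hx' : x = (UnitDisc.mk x (mem_ball_zero_iff.1 hx.1) : 𝔻) := rfl
      rw [hx']
      exact (hd _ fun h => hx.2 ⟨_, h, rfl⟩).differentiableWithinAt)
    (fun z hz => by
      rw [UnitDisc.extend_coe]
      exact hle z fun h => hz ⟨_, h, rfl⟩) (by
      have hev : ∀ᶠ y : 𝔻 in cocompact 𝔻, X.toDisc y ∉ S := hT.isCompact.compl_mem_cocompact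
      simp only [UnitDisc.extend_coe]
      refine tendsto_one_of_forall_lt (hev.mono fun y hy => (hle y hy).le) fun c hc => ?_
      obtain ⟨e, he0, he1, hec⟩ : ∃ e : ℝ, 0 < e ∧ e < 1 ∧ c < e ^ d := by
        have h1 : ∀ᶠ e : ℝ in 𝓝[<] 1, c < e ^ d :=
          ((continuous_pow d).tendsto' 1 1 (one_pow d)).mono_left nhdsWithin_le_nhds
            |>.eventually_const_lt hc
        have h2 : ∀ᶠ e : ℝ in 𝓝[<] 1, 0 < e :=
          nhdsWithin_le_nhds (lt_mem_nhds one_pos)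
        obtain ⟨e, h1, h2, h3⟩ := (h1.and (h2.and self_mem_nhdsWithin)).exists
        exact ⟨e, h2, h3, h1⟩
      obtain ⟨K, hK, hKc⟩ := mem_cocompact.1
        ((tendsto_norm_discMobius p.norm_lt_one).eventually_const_lt he1)
      have hev2 : ∀ᶠ y : 𝔻 in cocompact 𝔻, X.toDisc y ∉ A.toDisc '' K :=
        X.tendsto_cocompact (hK.image A.continuous_toDisc).compl_mem_cocompact
      filter_upwards [hev, hev2] with y hy hyK
      obtain ⟨zs, i, hzs, hFy⟩ := hF y hy
      rw [hFy]
      refine hec.trans_le (pow_le_norm_classProd he0.le he1.le fun j => ?_)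
      exact le_of_lt (hKc fun hj => hyK ⟨zs j, hj, hzs j⟩))
  exact ⟨R, fun y hy => (hR y fun ⟨x, hx, hxy⟩ =>
    hy (UnitDisc.coe_injective hxy ▸ hx)).trans (UnitDisc.extend_coe F y)⟩

section

variable {φ : ℂ → ℂ} {F G : 𝔻 → ℂ} (hFG : ∀ w zs ys, IsTransport a b w zs ys → ∀ i,
  F (zs i) = classProd (monodromySetoid A B a b) φ zs i ∧
  G (ys i) = classProd (monodromySetoid A B a b) φ zs i)
include hFG

open Classical in
/-- Near a regular point the block functions are products of local sections of `A`. -/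
theorem exists_eventuallyEq_prod {w : 𝔻} {zs ys : Fin d → 𝔻} (h : IsTransport a b w zs ys) :
    ∃ s : Fin d → ℂ → ℂ, (∀ j, s j w = zs j) ∧
      (∀ j, HasDerivAt (s j) (deriv (ratValue A.rat) (zs j))⁻¹ w) ∧
      ∀ i, (UnitDisc.extend F =ᶠ[𝓝 (zs i : ℂ)] fun x =>
          ∏ j with monodromySetoid A B a b i j, φ (s j (ratValue A.rat x))) ∧
        UnitDisc.extend G =ᶠ[𝓝 (ys i : ℂ)] fun x =>
          ∏ j with monodromySetoid A B a b i j, φ (s j (ratValue B.rat x)) := by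
  obtain ⟨s, hs0, hsd, hs⟩ := h.exists_localSections
  refine ⟨s, hs0, hsd, fun i => ⟨?_, ?_⟩⟩
  · refine UnitDisc.extend_eventuallyEq ((hs i).1.mono ?_)
    rintro z ⟨zs', ys', h', rfl, hzs⟩
    rw [(hFG _ _ _ h' i).1, classProd]
    exact Finset.prod_congr rfl fun j _ => by rw [hzs, coe_toDisc]
  · refine UnitDisc.extend_eventuallyEq ((hs i).2.mono ?_)
    rintro y ⟨zs', ys', h', rfl, hzs⟩
    rw [(hFG _ _ _ h' i).2, classProd]
    exact Finset.prod_congr rfl fun j _ => by rw [hzs, coe_toDisc]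

theorem differentiableAt_extend (hφ : ∀ z : 𝔻, DifferentiableAt ℂ φ z) {w : 𝔻}
    {zs ys : Fin d → 𝔻} (h : IsTransport a b w zs ys) (i : Fin d) :
    DifferentiableAt ℂ (UnitDisc.extend F) (zs i) ∧
      DifferentiableAt ℂ (UnitDisc.extend G) (ys i) := by
  classical
  obtain ⟨s, hs0, hsd, hs⟩ := exists_eventuallyEq_prod hFG h
  have key : ∀ (X : BlaschkeProduct) (x : 𝔻), X.toDisc x = w → DifferentiableAt ℂ (fun x =>
      ∏ j with monodromySetoid A B a b i j, φ (s j (ratValue X.rat x))) (x : ℂ) := by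
    intro X x hx
    have hx' : ratValue X.rat x = w := congrArg UnitDisc.coe hx
    refine DifferentiableAt.fun_finsetProd fun j _ => ?_
    have h1 : DifferentiableAt ℂ φ (s j (ratValue X.rat x)) := by
      rw [hx', hs0]; exact hφ _
    have h2 : DifferentiableAt ℂ (s j) (ratValue X.rat x) := by
      rw [hx']; exact (hsd j).differentiableAt
    exact h1.comp (x : ℂ) (h2.comp (x : ℂ) (X.hasStrictDerivAt x).hasDerivAt.differentiableAt)
  exact ⟨(key A _ (h.toDisc_left i)).congr_of_eventuallyEq (hs i).1,
    (key B _ (h.toDisc_right i)).congr_of_eventuallyEq (hs i).2⟩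

/-- With a Möbius transformation which vanishes at `a i₀` only, the block function has simple
zeros at the points of the block of `a i₀`. -/
theorem deriv_extend_ne_zero (hζA : ζ ∉ A.criticalValues) (hζB : ζ ∉ B.criticalValues)
    {i₀ i : Fin d} (hφ : φ = discMobius (a i₀ : 𝔻)) (hi : monodromySetoid A B a b i i₀) :
    deriv (UnitDisc.extend F) (a i : 𝔻) ≠ 0 := by
  classical
  subst hφ
  have hp := (a i₀ : 𝔻).norm_lt_one
  have hreg : ∀ j, deriv (ratValue A.rat) ((a j : 𝔻) : ℂ) ≠ 0 := fun j h0 =>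
    hζA ⟨a j, (a j).2, h0⟩
  have hval : ∀ j, ratValue A.rat ((a j : 𝔻) : ℂ) = ζ := fun j => congrArg UnitDisc.coe (a j).2
  obtain ⟨s, hs0, hsd, hs⟩ := exists_eventuallyEq_prod hFG (isTransport_self a b hζA hζB)
  have hcomp : ∀ j, HasDerivAt (fun x => s j (ratValue A.rat x))
      ((deriv (ratValue A.rat) ((a j : 𝔻) : ℂ))⁻¹ * deriv (ratValue A.rat) ((a i : 𝔻) : ℂ))
      ((a i : 𝔻) : ℂ) := fun j =>
    HasDerivAt.comp (h₂ := s j) _ (by rw [hval]; exact hsd j) (A.hasStrictDerivAt _).hasDerivAt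
  have hsj : ∀ j, s j (ratValue A.rat ((a i : 𝔻) : ℂ)) = (a j : 𝔻) := fun j => by
    rw [hval]; exact hs0 j
  have hu : HasDerivAt (fun x => discMobius (a i₀ : 𝔻) (s i₀ (ratValue A.rat x)))
      ((1 - (starRingEnd ℂ) (a i₀ : 𝔻) * (a i₀ : 𝔻))⁻¹ *
        ((deriv (ratValue A.rat) ((a i₀ : 𝔻) : ℂ))⁻¹ * deriv (ratValue A.rat) ((a i : 𝔻) : ℂ)))
      ((a i : 𝔻) : ℂ) :=
    HasDerivAt.comp (h₂ := discMobius (a i₀ : 𝔻)) _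
      (by rw [hsj]; exact hasDerivAt_discMobius_self hp) (hcomp i₀)
  have hv : DifferentiableAt ℂ (fun x =>
      ∏ j ∈ (Finset.univ.filter (monodromySetoid A B a b i)).erase i₀,
        discMobius (a i₀ : 𝔻) (s j (ratValue A.rat x))) ((a i : 𝔻) : ℂ) := by
    refine DifferentiableAt.fun_finsetProd fun j _ => ?_
    exact DifferentiableAt.comp (g := discMobius (a i₀ : 𝔻)) _
      (by rw [hsj]; exact differentiableAt_discMobius hp (a j : 𝔻).norm_lt_one)
      (hcomp j).differentiableAt
  have hprod := hu.mul hv.hasDerivAt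
  rw [(hs i).1.deriv_eq]
  have heq : (fun x => ∏ j with monodromySetoid A B a b i j,
      discMobius (a i₀ : 𝔻) (s j (ratValue A.rat x))) =
      (fun x => discMobius (a i₀ : 𝔻) (s i₀ (ratValue A.rat x))) * fun x =>
      ∏ j ∈ (Finset.univ.filter (monodromySetoid A B a b i)).erase i₀,
        discMobius (a i₀ : 𝔻) (s j (ratValue A.rat x)) := by
    funext x
    exact (Finset.mul_prod_erase _ _ (by simpa using hi)).symm
  rw [heq, hprod.deriv, hsj, (discMobius_eq_zero hp hp).2 rfl, zero_mul, add_zero]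
  refine mul_ne_zero (mul_ne_zero (inv_ne_zero (one_sub_conj_mul_ne_zero hp hp))
    (mul_ne_zero (inv_ne_zero (hreg _)) (hreg _))) (Finset.prod_ne_zero_iff.2 fun j hj => ?_)
  rw [hsj, Ne, discMobius_eq_zero hp (a j : 𝔻).norm_lt_one]
  intro h
  exact (Finset.mem_erase.1 hj).1 (a.injective (Subtype.ext (UnitDisc.coe_injective h)))

/-- A Blaschke product which extends the block function has its zeros in the fibre over `ζ`: away
from it the values of the Möbius transformation on the blocks are bounded below. -/
theorem toDisc_eq_of_extends_of_eq_zero (hζA : ζ ∉ A.criticalValues) (hζB : ζ ∉ B.criticalValues)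
    {i₀ : Fin d} (hφ : φ = discMobius (a i₀ : 𝔻)) {A₁ : BlaschkeProduct}
    (hA₁ : ∀ z, A.toDisc z ∉ A.criticalValues ∪ B.criticalValues → ratValue A₁.rat z = F z)
    {z : 𝔻} (hz : ratValue A₁.rat z = 0) : A.toDisc z = ζ := by
  subst hφ
  by_contra hne
  obtain ⟨V, W, hV, hW, hzV, hζW, hVW⟩ := t2_separation hne
  have hN : A.toDisc ⁻¹' W ∈ 𝓝 (a i₀ : 𝔻) :=
    A.continuous_toDisc.continuousAt.preimage_mem_nhds (hW.mem_nhds (by rwa [(a i₀).2]))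
  have hN' := UnitDisc.isOpenEmbedding_coe.image_mem_nhds.2 hN
  obtain ⟨ε, hε, hball⟩ := Metric.mem_nhds_iff.1 hN'
  obtain ⟨e, he0, he⟩ := exists_between (lt_min (half_pos hε) one_pos)
  have he1 : e < ε / 2 := he.trans_le (min_le_left _ _)
  have he2 : e ≤ 1 := (he.trans_le (min_le_right _ _)).le
  have hlow : ∀ x : 𝔻, A.toDisc x ∈ V → e ≤ ‖discMobius (a i₀ : 𝔻) x‖ := by
    intro x hx
    by_contra hlt
    have h1 := norm_sub_le_two_mul_norm_discMobius (a i₀ : 𝔻).norm_lt_one x.norm_lt_one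
    obtain ⟨y, hy, hyx⟩ := hball (show (x : ℂ) ∈ ball ((a i₀ : 𝔻) : ℂ) ε by
      rw [mem_ball_iff_norm]; linarith)
    rw [UnitDisc.coe_injective hyx] at hy
    exact (disjoint_left.1 hVW) hx hy
  have hopen : IsOpen ({x : 𝔻 | ‖(A₁.toDisc x : ℂ)‖ < e ^ d} ∩ A.toDisc ⁻¹' V) :=
    (isOpen_lt (UnitDisc.continuous_coe.comp A₁.continuous_toDisc).norm continuous_const).inter
      (hV.preimage A.continuous_toDisc)
  obtain ⟨x, ⟨hx1, hx2⟩, hx3⟩ := (UnitDisc.dense_compl (A.finite_preimage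
    (A.finite_criticalValues.union B.finite_criticalValues))).inter_open_nonempty _ hopen
    ⟨z, by simp [coe_toDisc, hz, he0], hzV⟩
  obtain ⟨zs, ys, htr⟩ := exists_isTransport a b hζA hζB hx3
  obtain ⟨i, rfl⟩ := htr.exists_left rfl
  have h1 : ‖ratValue A₁.rat (zs i)‖ < e ^ d := hx1
  rw [hA₁ _ hx3, (hFG _ _ _ htr i).1] at h1
  refine not_le.2 h1 (pow_le_norm_classProd he0.le he2 fun j => hlow _ ?_)
  rw [htr.toDisc_left j]
  exact hx2

end

end BlaschkeProduct

end Construction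

section Factorization

open Complex Filter Topology Metric Set
open scoped Complex.UnitDisc

/-! ### Factorization through the block functions -/

namespace BlaschkeProduct

/-- If `A` is constant on all but finitely many fibres of `A₁`, then `A` factors through `A₁`. -/
theorem exists_ratComp_of_fibres {A A₁ : BlaschkeProduct} {T : Set 𝔻} (hT : T.Finite)
    (h : ∀ z ∉ T, ∀ z', A₁.toDisc z' = A₁.toDisc z → A.toDisc z' = A.toDisc z) :
    ∃ C : BlaschkeProduct, A.rat = ratComp C.rat A₁.rat := by
  obtain ⟨σ, hσ⟩ := A₁.surjective.hasRightInverse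
  have hσ' : ∀ u, A₁.toDisc (σ u) = u := hσ
  set S : Set 𝔻 := A₁.toDisc '' T ∪ A₁.criticalValues with hS
  have hSfin : S.Finite := (hT.image _).union A₁.finite_criticalValues
  have hST : ∀ z, A₁.toDisc z ∉ S → z ∉ T := fun z hz hzT => hz (.inl ⟨z, hzT, rfl⟩)
  have hdiff : ∀ u : 𝔻, u ∉ S →
      DifferentiableAt ℂ (UnitDisc.extend fun u => (A.toDisc (σ u) : ℂ)) u := by
    intro u hu
    have hd : deriv (ratValue A₁.rat) (σ u) ≠ 0 := fun h0 => hu (.inr ⟨σ u, hσ' u, h0⟩)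
    obtain ⟨s, hs0, hsd, -, hsr⟩ := exists_localSection A₁ hd
    rw [hσ'] at hs0 hsd hsr
    have hev : ∀ᶠ v : 𝔻 in 𝓝 u, (A.toDisc (σ v) : ℂ) = ratValue A.rat (s v) := by
      filter_upwards [UnitDisc.continuous_coe.continuousAt.eventually hsr,
        hSfin.isClosed.isOpen_compl.eventually_mem hu] with v hv hvS
      have h1 : A₁.toDisc (UnitDisc.mk (s v) hv.2.1) = v := UnitDisc.coe_injective hv.2.2
      have h2 := h (UnitDisc.mk (s v) hv.2.1) (hST _ (by rwa [h1])) (σ v) (by rw [hσ', h1])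
      exact congrArg UnitDisc.coe h2
    refine DifferentiableAt.congr_of_eventuallyEq ?_
      (UnitDisc.extend_eventuallyEq (g := fun x => ratValue A.rat (s x)) hev)
    exact DifferentiableAt.comp (g := ratValue A.rat) _
      (by rw [hs0]; exact (A.hasStrictDerivAt _).hasDerivAt.differentiableAt)
      hsd.differentiableAt
  have hσt : Tendsto σ (cocompact 𝔻) (cocompact 𝔻) := by
    refine (hasBasis_cocompact.tendsto_right_iff).2 fun K hK => ?_
    filter_upwards [(hK.image A₁.continuous_toDisc).compl_mem_cocompact] with u hu hK'
    exact hu ⟨σ u, hK', hσ' u⟩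
  obtain ⟨C, hC⟩ := exists_eq_of_differentiableOn (hSfin.image UnitDisc.coe)
    (f := UnitDisc.extend fun u => (A.toDisc (σ u) : ℂ))
    (fun x hx => (hdiff (UnitDisc.mk x (mem_ball_zero_iff.1 hx.1))
      fun h => hx.2 ⟨_, h, rfl⟩).differentiableWithinAt)
    (fun u _ => by rw [UnitDisc.extend_coe]; exact (A.toDisc (σ u)).norm_lt_one)
    (by
      simp only [UnitDisc.extend_coe]
      exact UnitDisc.tendsto_norm_cocompact.comp (A.tendsto_cocompact.comp hσt))
  refine ⟨C, rat_eq_ratComp (A₁.finite_preimage hSfin) fun z hz => UnitDisc.coe_injective ?_⟩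
  rw [coe_toDisc C, hC _ fun ⟨x, hx, hxz⟩ => hz (by
      rwa [mem_preimage, ← UnitDisc.coe_injective hxz]),
    UnitDisc.extend_coe, h z (hST z hz) (σ _) (hσ' _)]

variable {A B : BlaschkeProduct} {d : ℕ} {ζ : 𝔻} {a : Fin d ≃ A.Fibre ζ} {b : Fin d ≃ B.Fibre ζ}

/-- The block function has degree the size of the block of `a i₀`. -/
theorem degree_of_extends {F G : 𝔻 → ℂ} {i₀ : Fin d}
    (hFG : ∀ w zs ys, IsTransport a b w zs ys → ∀ i,
      F (zs i) = classProd (monodromySetoid A B a b) (discMobius (a i₀ : 𝔻)) zs i ∧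
      G (ys i) = classProd (monodromySetoid A B a b) (discMobius (a i₀ : 𝔻)) zs i)
    (hζA : ζ ∉ A.criticalValues) (hζB : ζ ∉ B.criticalValues) {A₁ : BlaschkeProduct}
    (hA₁ : ∀ z, A.toDisc z ∉ A.criticalValues ∪ B.criticalValues → ratValue A₁.rat z = F z) :
    (∀ j, ratValue A₁.rat (a j : 𝔻) = 0 ↔ monodromySetoid A B a b i₀ j) ∧
      A₁.degree = Nat.card {j // monodromySetoid A B a b i₀ j} := by
  have hζ : ζ ∉ A.criticalValues ∪ B.criticalValues := fun h => h.elim hζA hζB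
  have hzero : ∀ j, ratValue A₁.rat (a j : 𝔻) = 0 ↔ monodromySetoid A B a b i₀ j := by
    intro j
    rw [hA₁ _ (by rwa [(a j).2]), (hFG _ _ _ (isTransport_self a b hζA hζB) j).1,
      classProd_eq_zero_iff]
    simp only [discMobius_eq_zero (a i₀ : 𝔻).norm_lt_one (UnitDisc.norm_lt_one _),
      UnitDisc.coe_inj, Subtype.coe_inj, a.injective.eq_iff, exists_eq_right]
    exact ⟨fun h => Setoid.symm' _ h, fun h => Setoid.symm' _ h⟩
  refine ⟨hzero, ?_⟩
  have hfib : ∀ z : 𝔻, A₁.toDisc z = 0 → ∃ j, monodromySetoid A B a b i₀ j ∧ (a j : 𝔻) = z := by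
    intro z hz
    have hz' : ratValue A₁.rat z = 0 := congrArg UnitDisc.coe hz
    have hAz := toDisc_eq_of_extends_of_eq_zero hFG hζA hζB rfl hA₁ hz'
    obtain ⟨j, hj⟩ := a.surjective ⟨z, hAz⟩
    have hjz : (a j : 𝔻) = z := congrArg Subtype.val hj
    exact ⟨j, (hzero j).1 (by rwa [hjz]), hjz⟩
  have hreg : (0 : 𝔻) ∉ A₁.criticalValues := by
    rintro ⟨z, hz, hd⟩
    obtain ⟨j, hj, rfl⟩ := hfib z hz
    refine deriv_extend_ne_zero hFG hζA hζB rfl (Setoid.symm' _ hj) ?_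
    have hev : ∀ᶠ x : 𝔻 in 𝓝 (a j : 𝔻), F x = ratValue A₁.rat x := by
      have hcl := (A.finite_criticalValues.union B.finite_criticalValues).isClosed.isOpen_compl
      filter_upwards [A.continuous_toDisc.continuousAt.eventually_mem
        (hcl.mem_nhds (by rwa [mem_compl_iff, (a j).2]))] with x hx
      exact (hA₁ x hx).symm
    rw [(UnitDisc.extend_eventuallyEq hev).deriv_eq, hd]
  rw [← A₁.card_fibre hreg]
  refine (Nat.card_eq_of_bijective
    (fun j : {j // monodromySetoid A B a b i₀ j} =>
      (⟨a j, UnitDisc.coe_injective ((hzero j).2 j.2)⟩ : A₁.Fibre 0)) ⟨fun j k hjk => ?_,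
      fun z => ?_⟩).symm
  · exact Subtype.ext (a.injective (Subtype.ext (congrArg (fun z : A₁.Fibre 0 => (z : 𝔻)) hjk)))
  · obtain ⟨j, hj, hjz⟩ := hfib z z.2
    exact ⟨⟨j, hj⟩, Subtype.ext hjz⟩

/-- If `∼` is non-trivial, the block functions of `A` and `B` are Blaschke products which are
right factors of `A` and `B`, with a common left factor. -/
theorem exists_ratComp_of_isNontrivialRel (hζA : ζ ∉ A.criticalValues)
    (hζB : ζ ∉ B.criticalValues) (h : IsNontrivialRel (monodromySetoid A B a b)) :
    ∃ A₁ B₁ C : BlaschkeProduct, 1 < C.degree ∧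
      A.rat = ratComp C.rat A₁.rat ∧ B.rat = ratComp C.rat B₁.rat := by
  set U : Set 𝔻 := A.criticalValues ∪ B.criticalValues with hU
  have hUfin : U.Finite := A.finite_criticalValues.union B.finite_criticalValues
  rw [IsNontrivialRel] at h
  push Not at h
  obtain ⟨j₁, k₁, hjk⟩ := h
  have : Nonempty (Fin d) := ⟨j₁⟩
  -- The class of `i₀` has minimal size, so that blocks are never smaller than the degree of `A₁`.
  obtain ⟨i₀, hmin⟩ := Finite.exists_min fun i => Nat.card {j // monodromySetoid A B a b i j}
  obtain ⟨F, G, hFG⟩ := exists_blockFunctions a b (discMobius (a i₀ : 𝔻))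
  have hφ : ∀ z : 𝔻, DifferentiableAt ℂ (discMobius (a i₀ : 𝔻)) z := fun z =>
    differentiableAt_discMobius (a i₀ : 𝔻).norm_lt_one z.norm_lt_one
  obtain ⟨A₁, hA₁⟩ := exists_eq_of_blockProduct A hUfin (a i₀ : 𝔻) (A := A) (F := F)
    (monodromySetoid A B a b) (fun z hz => by
      obtain ⟨zs, ys, ht⟩ := exists_isTransport a b hζA hζB hz
      obtain ⟨i, hi⟩ := ht.exists_left rfl
      exact ⟨zs, i, ht.toDisc_left, hi ▸ (hFG _ _ _ ht i).1⟩)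
    (fun z hz => by
      obtain ⟨zs, ys, ht⟩ := exists_isTransport a b hζA hζB hz
      obtain ⟨i, rfl⟩ := ht.exists_left rfl
      exact (differentiableAt_extend hFG hφ ht i).1)
  obtain ⟨B₁, hB₁⟩ := exists_eq_of_blockProduct B hUfin (a i₀ : 𝔻) (A := A) (F := G)
    (monodromySetoid A B a b) (fun y hy => by
      obtain ⟨zs, ys, ht⟩ := exists_isTransport a b hζA hζB hy
      obtain ⟨i, hi⟩ := ht.exists_right rfl
      exact ⟨zs, i, ht.toDisc_left, hi ▸ (hFG _ _ _ ht i).2⟩)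
    (fun y hy => by
      obtain ⟨zs, ys, ht⟩ := exists_isTransport a b hζA hζB hy
      obtain ⟨i, rfl⟩ := ht.exists_right rfl
      exact (differentiableAt_extend hFG hφ ht i).2)
  obtain ⟨hzero, hdeg⟩ := degree_of_extends hFG hζA hζB hA₁
  have hval : ∀ w zs ys, IsTransport a b w zs ys → ∀ i, ratValue A₁.rat (zs i) =
      classProd (monodromySetoid A B a b) (discMobius (a i₀ : 𝔻)) zs i := fun w zs ys ht i => by
    rw [hA₁ _ (by rw [ht.toDisc_left i]; exact fun h => h.elim ht.notMem.1 ht.notMem.2),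
      (hFG _ _ _ ht i).1]
  -- A fibre of `A₁` contains a block and has at most as many points, so it is this block.
  obtain ⟨C, hC⟩ := exists_ratComp_of_fibres (A := A) (A₁ := A₁) (A.finite_preimage hUfin)
    fun z hz z' hz' => by
      obtain ⟨zs, ys, ht⟩ := exists_isTransport a b hζA hζB (w := A.toDisc z) hz
      obtain ⟨i, hi⟩ := ht.exists_left rfl
      let f : {j // monodromySetoid A B a b i j} → A₁.Fibre (A₁.toDisc z) := fun j =>
        ⟨zs j, UnitDisc.coe_injective (by
          rw [← hi, coe_toDisc, coe_toDisc, hval _ _ _ ht, hval _ _ _ ht,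
            classProd_congr (Setoid.symm' _ j.2)])⟩
      have hf : Function.Injective f := fun j k hjk =>
        Subtype.ext (ht.injective_left (congrArg (fun x : A₁.Fibre _ => (x : 𝔻)) hjk))
      have hbij := hf.bijective_of_nat_card_le
        ((A₁.card_fibre_le _).trans (hdeg.le.trans (hmin i)))
      obtain ⟨j, hj⟩ := hbij.2 ⟨z', hz'⟩
      have hj' : zs j = z' := congrArg Subtype.val hj
      rw [← hj', ht.toDisc_left]
  refine ⟨A₁, B₁, C, ?_, hC, ?_⟩
  · -- `C` takes the value `ζ` at `A₁ (a i₀) = 0` and at `A₁ (a i) ≠ 0` for `i` in another class.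
    obtain ⟨i, hi⟩ : ∃ i, ¬ monodromySetoid A B a b i₀ i := by
      by_contra hall
      push Not at hall
      exact hjk (Setoid.trans' _ (Setoid.symm' _ (hall j₁)) (hall k₁))
    refine lt_of_lt_of_le ?_ (C.card_fibre_le ζ)
    have hmem : ∀ j, C.toDisc (A₁.toDisc (a j)) = ζ := fun j => by
      rw [← toDisc_eq_of_ratComp hC, (a j).2]
    refine Finite.one_lt_card_iff_nontrivial.2 ⟨⟨_, hmem i₀⟩, ⟨_, hmem i⟩, fun heq => hi ?_⟩
    have h0 := (hzero i₀).2 (Setoid.refl' _ _)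
    rw [← hzero i, ← h0]
    exact congrArg (fun x : C.Fibre ζ => ((x : 𝔻) : ℂ)) heq.symm
  · refine rat_eq_ratComp (B.finite_preimage hUfin) fun y hy => ?_
    obtain ⟨zs, ys, ht⟩ := exists_isTransport a b hζA hζB (w := B.toDisc y) hy
    obtain ⟨i, hi⟩ := ht.exists_right rfl
    have h1 : B₁.toDisc y = A₁.toDisc (zs i) := UnitDisc.coe_injective (by
      rw [coe_toDisc, coe_toDisc, hval _ _ _ ht, hB₁ y hy, ← hi, (hFG _ _ _ ht i).2])
    rw [h1, ← toDisc_eq_of_ratComp hC, ht.toDisc_left]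

end BlaschkeProduct

end Factorization

theorem theoremB (d : ℕ) (A B : BlaschkeProduct) (hA : A.degree = d) (hB : B.degree = d)
    (ζ : Complex.UnitDisc) (hζA : ζ ∉ A.criticalValues) (hζB : ζ ∉ B.criticalValues) :
    (∃ A₁ B₁ C : BlaschkeProduct, 1 < C.degree ∧
      A.rat = ratComp C.rat A₁.rat ∧ B.rat = ratComp C.rat B₁.rat) ↔
    ∃ (a : Fin d ≃ A.Fibre ζ) (b : Fin d ≃ B.Fibre ζ),
      BlaschkeProduct.IsNontrivialRel (BlaschkeProduct.monodromySetoid A B a b) := by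
  constructor
  · rintro ⟨A₁, B₁, C, hC, h, h'⟩
    exact BlaschkeProduct.exists_isNontrivialRel_of_ratComp h hA hB hζA hζB hC h'
  · rintro ⟨a, b, h⟩
    exact BlaschkeProduct.exists_ratComp_of_isNontrivialRel hζA hζB h
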